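/- **Setting.** For $k\in\mathbb N=\{1,2,\dots\}$ let $A_{1,k}=[0,1/k]$ and $A_{j,k}=((j-1)/k,\,j/k]$ ($2\le j\le k$), let $c_{j,k}=(j-1/2)/k$, and let $A_{j,k}^-$ and $A_{j,k}^+$ be the left and the right half of $A_{j,k}$. For weights $\mathbf w_k=(w_{1,k},\dots,w_{k,k})$ in the simplex, the polygon $p_{\mathbf w_k}$ is $$p_{\mathbf w_k}(x)=w_{1,k}k\mathbf 1_{A_{1,k}^-}(x)+\sum_{j=1}^{k-1}\big[k(c_{j+1,k}-x)w_{j,k}+k(x-c_{j,k})w_{j+1,k}\big]k\,\mathbf 1_{A_{j,k}^+\cup A_{j+1,k}^-}(x)+w_{k,k}k\mathbf 1_{A_{k,k}^+}(x),\qquad x\in[0,1].$$ Let $\rho$ be a probability mass function on $\mathbb N$ and $\alpha$ a finite measure on $[0,1]$. The polygonally smoothed prior $\Pi$ is the law of the random density $f_P=p_{\mathbf w_k}$, where $k\sim\rho$ and, given $k$, $\mathbf w_k=(P(A_{1,k}),\dots,P(A_{k,k}))$ with $P$ a Dirichlet process with base measure $\alpha$, i.e. $\mathbf w_k\sim\mathrm{Dir}_k(\alpha(A_{1,k}),\dots,\alpha(A_{k,k}))$.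 For data $X^{(n)}=(X_1,\dots,X_n)$ let $\Pi(\cdot\mid X^{(n)})\propto\prod_{i=1}^n f_P(X_i)\,\Pi(\mathrm dP)$ be the posterior and $\hat f_n(x)=\int f_P(x)\,\Pi(\mathrm dP\mid X^{(n)})$ the Bayes estimator. Write $\|\cdot\|_1$ for the $L^1$-norm with respect to Lebesgue measure $\lambda$ on $[0,1]$, and $\mathbb E_0^n$ for the expectation when $X_1,\dots,X_n$ are i.i.d. with density $f_0$. A function on $[0,1]$ is Hölder $\beta$-smooth if, with $m$ the largest integer $\geq 0$ that is strictly smaller than $\beta$, it is $m$ times differentiable and its $m$-th derivative is Hölder continuous on $[0,1]$ with exponent $\beta-m$. **Theorem.** Let $\Pi$ be a polygonally smoothed prior such that, for some constants $B_1,B_2,\beta_1,\beta_2>0$, $B_1e^{-\beta_1k\log k}\le\rho(k)\le B_2e^{-\beta_2k\log k}$ for all $k\in\mathbb N$, and such that $\alpha$ has a continuous and positive Lebesgue density on $[0,1]$. Let $\beta\in(0,2]$ and let $f_0$ be a Hölder $\beta$-smooth probability density on $[0,1]$ with $1/f_0\in L^1(\lambda)$. If $\beta>1$, suppose in addition that there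 are $a_0,b_0\in\mathbb R$ and $p,q\in[\beta-1,\infty)$ with - (BC1) $f_0'(x)=a_0x^p+o(x^p)$ as $x\downarrow0$, - (BC2) $f_0'(x)=b_0(1-x)^q+o((1-x)^q)$ as $x\uparrow1$. Then, for every sufficiently large constant $M>0$, $$\mathbb E_0^n\Big[\Pi\big(P:\ \|f_P-f_0\|_1>M\,n^{-\beta/(2\beta+1)}(\log n)^{\beta/(2\beta+1)}\,\big|\,X^{(n)}\big)\Big]\to0\qquad(n\to\infty),$$ and $$\mathbb E_0^n\big[\|\hat f_n-f_0\|_1^2\big]=O\big(n^{-2\beta/(2\beta+1)}(\log n)^{2\beta/(2\beta+1)}\big).$$ The prior does not depend on $\beta$; the constants ($M$ and the one in $O$) may depend on $f_0$, $\beta$ and the prior. -/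

import Mathlib

open MeasureTheory ProbabilityTheory Set Filter Topology Asymptotics

noncomputable section

namespace RandomPolygon

/-- The Lebesgue measure on `[0, 1]`. -/
def lam : Measure ℝ := volume.restrict (Icc 0 1)

/-- The bins of the partition of `[0, 1]` into `k` intervals of length `1 / k`, numbered from `0`:
`bin k 0 = [0, 1/k]` and `bin k j = (j/k, (j+1)/k]` for `1 ≤ j ≤ k - 1`. -/
def bin (k j : ℕ) : Set ℝ :=
  if j = 0 then Icc 0 (1 / (k : ℝ)) else Ioc ((j : ℝ) / k) (((j : ℝ) + 1) / k)

/-- The midpoint of the bin number `j` (numbered from `0`). -/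
def mid (k j : ℕ) : ℝ := ((j : ℝ) + 1 / 2) / k

/-- The left half of a bin. -/
def leftHalf (k j : ℕ) : Set ℝ := bin k j ∩ Iic (mid k j)

/-- The right half of a bin. -/
def rightHalf (k j : ℕ) : Set ℝ := bin k j ∩ Ioi (mid k j)

/-- The polygon with weights `w`: it takes the value `k * w j` at the midpoint of the bin `j`, it is
linear between consecutive midpoints, and constant on the first and the last half-bin.
Bins and weights are numbered from `0`. -/
def polygon (k : ℕ+) (w : Fin k → ℝ) (x : ℝ) : ℝ :=
  (leftHalf k 0).indicator (fun _ => w ⟨0, k.pos⟩ * k) x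
  + ∑ j : Fin ((k : ℕ) - 1),
      (rightHalf k j ∪ leftHalf k (j + 1)).indicator
        (fun y => ((k : ℝ) * (mid k (j + 1) - y) * w ⟨j, by omega⟩
          + (k : ℝ) * (y - mid k j) * w ⟨j + 1, by omega⟩) * k) x
  + (rightHalf k ((k : ℕ) - 1)).indicator
      (fun _ => w ⟨(k : ℕ) - 1, Nat.sub_lt k.pos Nat.one_pos⟩ * k) x

/-- The Dirichlet distribution with positive parameters `a 0, …, a (k-1)`: the law of
`(G 0 / S, …, G (k-1) / S)`, where the `G j` are independent Gamma variables with shapes `a j` and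
rate `1`, and `S` is their sum. -/
def dirichlet {k : ℕ} (a : Fin k → ℝ) : Measure (Fin k → ℝ) :=
  (Measure.pi fun j => gammaMeasure (a j) 1).map fun g j => g j / ∑ i, g i

/-- The parameter space: a number `k ≥ 1` of bins together with a vector of `k` weights. -/
abbrev Param : Type := Σ k : ℕ+, (Fin k → ℝ)

/-- The density that belongs to a parameter. -/
def Param.density (θ : Param) : ℝ → ℝ := polygon θ.1 θ.2

/-- The polygonally smoothed prior: `k` is drawn from `ρ`, and, given `k`, the weights are
distributed as `(P(A_1), …, P(A_k))`, where `A_1, …, A_k` are the `k` bins and `P` is a Dirichlet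
process with base measure `α`, that is, as `Dir_k(α(A_1), …, α(A_k))`. -/
def polygonPrior (ρ : PMF ℕ+) (α : Measure ℝ) : Measure Param :=
  Measure.sum fun k : ℕ+ =>
    ρ k • (dirichlet fun j : Fin k => (α (bin k j)).toReal).map (fun w => (⟨k, w⟩ : Param))

/-- The likelihood of a parameter, given the data. -/
def likelihood {n : ℕ} (X : Fin n → ℝ) (θ : Param) : ENNReal :=
  ∏ i, ENNReal.ofReal (θ.density (X i))

/-- The posterior distribution, by Bayes' formula. -/
def postDist (π : Measure Param) {n : ℕ} (X : Fin n → ℝ) : Measure Param :=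
  (∫⁻ θ, likelihood X θ ∂π)⁻¹ • π.withDensity (likelihood X)

/-- The Bayes estimator (posterior expected density, predictive density). -/
def bayesEstimator (π : Measure Param) {n : ℕ} (X : Fin n → ℝ) (x : ℝ) : ℝ :=
  ∫ θ, θ.density x ∂(postDist π X)

/-- The `L¹`-distance on `[0, 1]`. -/
def distL1 (f g : ℝ → ℝ) : ENNReal := eLpNorm (fun x => f x - g x) 1 lam

/-- The joint law of `n` independent observations with density `f₀` on `[0, 1]`. -/
def sampleLaw (f₀ : ℝ → ℝ) (n : ℕ) : Measure (Fin n → ℝ) :=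
  Measure.pi fun _ => lam.withDensity fun x => ENNReal.ofReal (f₀ x)

/-- `f` is a probability density on `[0, 1]`. -/
def IsDensity (f : ℝ → ℝ) : Prop :=
  (∀ x ∈ Icc (0 : ℝ) 1, 0 ≤ f x) ∧ ∫⁻ x, ENNReal.ofReal (f x) ∂lam = 1

/-- `f` is Hölder `β`-smooth on `[0, 1]` (for `β > 0`): with `m` the largest natural number
`< β`, the derivative of order `m` exists and is Hölder continuous with exponent `β - m`. -/
def HolderSmooth (β : ℝ) (f : ℝ → ℝ) : Prop :=
  ContDiffOn ℝ ((⌈β⌉₊ - 1 : ℕ) : WithTop ℕ∞) f (Icc 0 1) ∧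
  ∃ L : ℝ, 0 < L ∧ ∀ x ∈ Icc (0 : ℝ) 1, ∀ y ∈ Icc (0 : ℝ) 1,
    |iteratedDerivWithin (⌈β⌉₊ - 1) f (Icc 0 1) x - iteratedDerivWithin (⌈β⌉₊ - 1) f (Icc 0 1) y|
      ≤ L * |x - y| ^ (β - ((⌈β⌉₊ - 1 : ℕ) : ℝ))

/-- The boundary condition at `0`: `f'(x) = a₀ x^p + o(x^p)` as `x ↓ 0`, with `β - 1 ≤ p`. -/
def BC1 (β : ℝ) (f : ℝ → ℝ) : Prop :=
  ∃ a₀ p : ℝ, β - 1 ≤ p ∧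
    (fun x => derivWithin f (Icc 0 1) x - a₀ * x ^ p) =o[𝓝[>] 0] fun x => x ^ p

/-- The boundary condition at `1`: `f'(x) = b₀ (1-x)^q + o((1-x)^q)` as `x ↑ 1`,
with `β - 1 ≤ q`. -/
def BC2 (β : ℝ) (f : ℝ → ℝ) : Prop :=
  ∃ b₀ q : ℝ, β - 1 ≤ q ∧
    (fun x => derivWithin f (Icc 0 1) x - b₀ * (1 - x) ^ q) =o[𝓝[<] 1] fun x => (1 - x) ^ q

/-- The rate `n^{-β/(2β+1)} (log n)^{β/(2β+1)}`. -/
def rate (β : ℝ) (n : ℕ) : ℝ :=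
  (n : ℝ) ^ (-(β / (2 * β + 1))) * Real.log n ^ (β / (2 * β + 1))

end RandomPolygon

end

/-!
The posterior of a set `V` is the integral of the likelihood ratio over `V`, divided by the
evidence. The evidence is bounded below through a chi-square ball around `f₀`: by AM-GM and Markov's
inequality it exceeds `exp (-c n ε²)` times the prior mass of the ball, up to an exceptional set of
samples. The numerator is bounded above by covering the densities far from `f₀` by boxes, each of
which is dominated by one function `u` that is almost a density. The Hellinger affinity of `u` and
`f₀` is then at most `exp (-c M² ε²)`, and it bounds the expected square root of the supremum of
the likelihood ratio over the box, so that no tests are needed.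

For the prior mass, the polygon with weights `f₀ (mid k j) / k` approximates `f₀` up to a multiple
of `k ^ (-β)`; the boundary conditions make up for its being constant on the two outer half-bins.
Since `1 / f₀` is integrable, a small relative perturbation of these weights stays within chi-square
distance `k ^ (-2β)`, and by the Gamma representation of the Dirichlet distribution such weights
have prior mass at least `exp (-D k log k)`. The prior tail `k > K` is negligible and the polygons
with at most `K` bins have entropy `K log n`. Balancing `k log n` with `n k ^ (-2β)` gives the rate.
-/

namespace RandomPolygon

open scoped ENNReal

/-! ### Posterior distributions under product likelihoods -/

theorem ae_pi_forall {ι : Type*} [Fintype ι] {E : ι → Type*} [∀ i, MeasurableSpace (E i)]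
    {μ : ∀ i, Measure (E i)} [∀ i, SigmaFinite (μ i)] {p : ∀ i, E i → Prop}
    (hp : ∀ i, ∀ᵐ x ∂μ i, p i x) : ∀ᵐ X ∂(Measure.pi μ), ∀ i, p i (X i) :=
  ae_all_iff.2 fun i => Measure.tendsto_eval_ae_ae.eventually (hp i)

section Posterior

variable {Θ 𝓧 : Type*} [MeasurableSpace Θ] {n : ℕ}

/-- The likelihood of the parameter `θ` in the model `r`, given the independent observations `X`.
Only ratios of likelihoods matter for the posterior, so `r θ` may be the density of `θ` with respect
to any measure, in particular with respect to the true law of an observation. -/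
noncomputable def iidLikelihood (r : Θ → 𝓧 → ℝ≥0∞) (X : Fin n → 𝓧) (θ : Θ) : ℝ≥0∞ := ∏ i, r θ (X i)

/-- The evidence (marginal likelihood) of the prior `π` in the model `r`, given the observations
`X`: the normalizing constant of the posterior. -/
noncomputable def evidence (r : Θ → 𝓧 → ℝ≥0∞) (π : Measure Θ) (X : Fin n → 𝓧) : ℝ≥0∞ :=
  ∫⁻ θ, iidLikelihood r X θ ∂π

/-- The posterior of the prior `π` in the model `r`, given the observations `X`. It is the zero
measure if the evidence is `0` or `∞`. -/
noncomputable def bayesPosterior (r : Θ → 𝓧 → ℝ≥0∞) (π : Measure Θ) (X : Fin n → 𝓧) :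
    Measure Θ :=
  (evidence r π X)⁻¹ • π.withDensity (iidLikelihood r X)

variable {r : Θ → 𝓧 → ℝ≥0∞} {π : Measure Θ} {X : Fin n → 𝓧}

theorem bayesPosterior_apply {S : Set Θ} (hS : MeasurableSet S) :
    bayesPosterior r π X S = (evidence r π X)⁻¹ * evidence r (π.restrict S) X := by
  rw [bayesPosterior, Measure.smul_apply, withDensity_apply _ hS, smul_eq_mul, evidence, evidence]

theorem bayesPosterior_absolutelyContinuous : bayesPosterior r π X ≪ π :=
  (withDensity_absolutelyContinuous π _).smul_left _

theorem bayesPosterior_le_one (S : Set Θ) : bayesPosterior r π X S ≤ 1 := by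
  refine (measure_mono (subset_univ S)).trans ?_
  rw [bayesPosterior_apply MeasurableSet.univ, Measure.restrict_univ]
  exact ENNReal.inv_mul_le_one _

theorem isProbabilityMeasure_bayesPosterior (h0 : evidence r π X ≠ 0) (h : evidence r π X ≠ ∞) :
    IsProbabilityMeasure (bayesPosterior r π X) :=
  ⟨by rw [bayesPosterior_apply MeasurableSet.univ, Measure.restrict_univ,
    ENNReal.inv_mul_cancel h0 h]⟩

theorem bayesPosterior_div {g : 𝓧 → ℝ≥0∞} (hg0 : ∀ i, g (X i) ≠ 0) (hg : ∀ i, g (X i) ≠ ∞) :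
    bayesPosterior (fun θ x => r θ x / g x) π X = bayesPosterior r π X := by
  set G := ∏ i, g (X i)
  have hG0 : G ≠ 0 := Finset.prod_ne_zero_iff.2 fun i _ => hg0 i
  have hG : G ≠ ∞ := ENNReal.prod_ne_top fun i _ => hg i
  have hfac : iidLikelihood r X = G • iidLikelihood (fun θ x => r θ x / g x) X := by
    ext θ
    simp only [iidLikelihood, G, Pi.smul_apply, smul_eq_mul, ← Finset.prod_mul_distrib]
    exact Finset.prod_congr rfl fun i _ => (ENNReal.mul_div_cancel (hg0 i) (hg i)).symm
  have hev : evidence r π X = G * evidence (fun θ x => r θ x / g x) π X := by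
    simp only [evidence, hfac, Pi.smul_apply, smul_eq_mul]
    exact lintegral_const_mul' _ _ hG
  rw [bayesPosterior, bayesPosterior, hev, hfac, withDensity_smul' _ _ hG, smul_smul,
    ENNReal.mul_inv (Or.inl hG0) (Or.inl hG), mul_right_comm, ENNReal.inv_mul_cancel hG0 hG,
    one_mul]

theorem bayesPosterior_le_mul_evidence {b : ℝ≥0∞} (hb : b⁻¹ ≤ evidence r π X) {S : Set Θ}
    (hS : MeasurableSet S) :
    bayesPosterior r π X S ≤ b * evidence r (π.restrict S) X := by
  rw [bayesPosterior_apply hS]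
  gcongr
  exact ENNReal.inv_le_iff_inv_le.1 hb

theorem le_rpow_of_le_one {a : ℝ≥0∞} (ha : a ≤ 1) {t : ℝ} (ht : t ≤ 1) : a ≤ a ^ t := by
  simpa only [ENNReal.rpow_one] using ENNReal.rpow_le_rpow_of_exponent_ge ha ht

-- A probability is at most its `t`-th power: for `t = 1 / 2`, likelihood ratios turn into their
-- square roots, whose expectations are Hellinger affinities.
theorem bayesPosterior_le_rpow [IsProbabilityMeasure π] {b : ℝ≥0∞} (hb : b⁻¹ ≤ evidence r π X)
    {S : Set Θ} (hS : MeasurableSet S) {u : 𝓧 → ℝ≥0∞} (hu : ∀ i, ∀ θ ∈ S, r θ (X i) ≤ u (X i))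
    {t : ℝ} (ht0 : 0 ≤ t) (ht1 : t ≤ 1) :
    bayesPosterior r π X S ≤ b ^ t * ∏ i, u (X i) ^ t := by
  rw [ENNReal.prod_rpow_of_nonneg ht0, ← ENNReal.mul_rpow_of_nonneg _ _ ht0]
  refine (le_rpow_of_le_one (bayesPosterior_le_one S) ht1).trans (ENNReal.rpow_le_rpow ?_ ht0)
  refine (bayesPosterior_le_mul_evidence hb hS).trans ?_
  gcongr
  calc evidence r (π.restrict S) X ≤ ∫⁻ _ in S, ∏ i, u (X i) ∂π :=
        setLIntegral_mono' hS fun θ hθ => Finset.prod_le_prod' fun i _ => hu i θ hθ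
    _ = (∏ i, u (X i)) * π S := setLIntegral_const S _
    _ ≤ ∏ i, u (X i) := mul_le_of_le_one_right' prob_le_one

variable {ι : Type*} {I : Finset ι} {U : ι → Set Θ} {u : ι → 𝓧 → ℝ≥0∞} {V S : Set Θ}

theorem bayesPosterior_le_add_sum [IsProbabilityMeasure π] {b : ℝ≥0∞}
    (hb : b⁻¹ ≤ evidence r π X) (hV : MeasurableSet V) (hU : ∀ i ∈ I, MeasurableSet (U i))
    (hu : ∀ j, ∀ i ∈ I, ∀ θ ∈ U i, r θ (X j) ≤ u i (X j)) (hS : S ⊆ V ∪ ⋃ i ∈ I, U i) {t : ℝ}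
    (ht0 : 0 ≤ t) (ht1 : t ≤ 1) :
    bayesPosterior r π X S
      ≤ b * evidence r (π.restrict V) X + ∑ i ∈ I, b ^ t * ∏ j, u i (X j) ^ t :=
  calc bayesPosterior r π X S
      ≤ bayesPosterior r π X V + bayesPosterior r π X (⋃ i ∈ I, U i) :=
        (measure_mono hS).trans (measure_union_le _ _)
    _ ≤ bayesPosterior r π X V + ∑ i ∈ I, bayesPosterior r π X (U i) :=
        add_le_add le_rfl (measure_biUnion_finset_le I U)
    _ ≤ _ := add_le_add (bayesPosterior_le_mul_evidence hb hV) (Finset.sum_le_sum fun i hi =>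
        bayesPosterior_le_rpow hb (hU i hi) (fun j => hu j i hi) ht0 ht1)

variable [MeasurableSpace 𝓧]

theorem measurable_iidLikelihood (hr : Measurable (Function.uncurry r)) :
    Measurable fun z : (Fin n → 𝓧) × Θ => iidLikelihood r z.1 z.2 :=
  Finset.measurable_prod _ fun i _ =>
    hr.comp (measurable_snd.prodMk ((measurable_pi_apply i).comp measurable_fst))

theorem measurable_evidence (hr : Measurable (Function.uncurry r)) [SFinite π] :
    Measurable fun X : Fin n → 𝓧 => evidence r π X :=
  (measurable_iidLikelihood hr).lintegral_prod_right'

variable {P₀ : Measure 𝓧} [IsProbabilityMeasure P₀]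

theorem lintegral_pi_prod {h : 𝓧 → ℝ≥0∞} (hh : Measurable h) :
    ∫⁻ X, ∏ i, h (X i) ∂(Measure.pi fun _ : Fin n => P₀) = (∫⁻ x, h x ∂P₀) ^ n := by
  rw [lintegral_prod_eq_prod_lintegral_of_indepFun (μ := Measure.pi fun _ : Fin n => P₀)
    Finset.univ (fun i X => h (X i)) (iIndepFun_pi fun _ => hh.aemeasurable) fun i => by fun_prop]
  simp only [(measurePreserving_eval (fun _ : Fin n => P₀) _).lintegral_comp hh,
    Finset.prod_const, Finset.card_univ, Fintype.card_fin]

theorem lintegral_evidence_le (hr : Measurable (Function.uncurry r)) [SFinite π] {s : ℝ≥0∞}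
    (hs : ∀ᵐ θ ∂π, ∫⁻ x, r θ x ∂P₀ ≤ s) :
    ∫⁻ X, evidence r π X ∂(Measure.pi fun _ : Fin n => P₀) ≤ s ^ n * π univ := by
  simp only [evidence]
  rw [lintegral_lintegral_swap (measurable_iidLikelihood hr).aemeasurable, ← lintegral_const]
  refine lintegral_mono_ae (hs.mono fun θ hθ => ?_)
  simp only [iidLikelihood]
  rw [lintegral_pi_prod (h := r θ) (hr.comp measurable_prodMk_left)]
  gcongr

theorem two_le_add_inv (z : ℝ≥0∞) : 2 ≤ z + z⁻¹ := by
  rcases eq_or_ne z 0 with rfl | h0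
  · simp
  rcases eq_or_ne z ∞ with rfl | h1
  · simp
  lift z to NNReal using h1
  have hz : (0 : ℝ) < z := by simpa [pos_iff_ne_zero] using h0
  rw [← ENNReal.coe_inv (by simpa using h0)]
  norm_cast
  rw [← NNReal.coe_le_coe]
  push_cast
  rw [← sub_nonneg, show (z : ℝ) + (z : ℝ)⁻¹ - 2 = ((z : ℝ) - 1) ^ 2 / z by field_simp; ring]
  positivity

theorem two_mul_le_evidence_add_evidence_inv (hr : Measurable (Function.uncurry r))
    (hX : ∀ i, ∀ θ, r θ (X i) ≠ ∞) {c : ℝ≥0∞} (hc0 : c ≠ 0) (hc : c ≠ ∞) :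
    2 * π univ ≤ c * evidence r π X + c⁻¹ * evidence (fun θ x => (r θ x)⁻¹) π X := by
  have hm : Measurable (iidLikelihood r X) :=
    (measurable_iidLikelihood hr).comp measurable_prodMk_left
  have hinv (θ : Θ) : iidLikelihood (fun θ x => (r θ x)⁻¹) X θ = (iidLikelihood r X θ)⁻¹ :=
    (ENNReal.prod_inv_distrib fun _ _ j _ _ => Or.inr (hX j θ)).symm
  simp only [evidence, hinv]
  rw [← lintegral_const_mul' _ _ hc, ← lintegral_const_mul' _ _ (ENNReal.inv_ne_top.2 hc0),
    ← lintegral_add_left (hm.const_mul c), ← lintegral_const]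
  refine lintegral_mono fun θ => ?_
  rw [← ENNReal.mul_inv (Or.inl hc0) (Or.inl hc)]
  exact two_le_add_inv _

-- By AM-GM, small evidence forces the integral of the inverse likelihood over `B` to be large,
-- which Markov's inequality makes improbable.
theorem pi_evidence_lt_le (hr : Measurable (Function.uncurry r))
    (hfin : ∀ᵐ x ∂P₀, ∀ θ, r θ x ≠ ∞) [IsFiniteMeasure π] {B : Set Θ} (hB : MeasurableSet B)
    (hB0 : π B ≠ 0) {s c : ℝ≥0∞} (hs : ∀ θ ∈ B, ∫⁻ x, (r θ x)⁻¹ ∂P₀ ≤ s) (hc0 : c ≠ 0)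
    (hc : c ≠ ∞) :
    Measure.pi (fun _ : Fin n => P₀) {X | c * evidence r π X < π B} ≤ c⁻¹ * s ^ n := by
  have hBt : π B ≠ ∞ := measure_ne_top π B
  have hri : Measurable (Function.uncurry fun θ x => (r θ x)⁻¹) := hr.inv
  have hsub : ∀ᵐ X ∂(Measure.pi fun _ : Fin n => P₀), c * evidence r π X < π B →
      c * π B ≤ evidence (fun θ x => (r θ x)⁻¹) (π.restrict B) X := by
    filter_upwards [ae_pi_forall fun _ => hfin] with X hX hlt
    have hsmall : c * evidence r (π.restrict B) X ≤ π B :=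
      (mul_le_mul_right (setLIntegral_le_lintegral _ _) c).trans hlt.le
    have hAMGM := two_mul_le_evidence_add_evidence_inv (π := π.restrict B) hr hX hc0 hc
    rw [Measure.restrict_apply_univ, two_mul] at hAMGM
    have hlarge := (ENNReal.add_le_add_iff_left hBt).1 (hAMGM.trans (add_le_add_left hsmall _))
    calc c * π B ≤ c * (c⁻¹ * _) := mul_le_mul_right hlarge c
      _ = _ := ENNReal.mul_inv_cancel_left hc0 hc
  calc Measure.pi (fun _ : Fin n => P₀) {X | c * evidence r π X < π B}
      ≤ Measure.pi (fun _ : Fin n => P₀)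
          {X | c * π B ≤ evidence (fun θ x => (r θ x)⁻¹) (π.restrict B) X} := measure_mono_ae hsub
    _ ≤ (∫⁻ X, evidence (fun θ x => (r θ x)⁻¹) (π.restrict B) X
          ∂(Measure.pi fun _ : Fin n => P₀)) / (c * π B) :=
        meas_ge_le_lintegral_div (measurable_evidence hri).aemeasurable (mul_ne_zero hc0 hB0)
          (ENNReal.mul_ne_top hc hBt)
    _ ≤ (s ^ n * π B) / (c * π B) := by
        gcongr
        simpa only [Measure.restrict_apply_univ] using
          lintegral_evidence_le (π := π.restrict B) hri (ae_restrict_of_forall_mem hB hs)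
    _ = c⁻¹ * s ^ n := by
        rw [ENNReal.mul_div_mul_right _ _ hB0 hBt, ENNReal.div_eq_inv_mul]

theorem ae_isProbabilityMeasure_bayesPosterior (hr : Measurable (Function.uncurry r))
    (hfin : ∀ᵐ x ∂P₀, ∀ θ, r θ x ≠ ∞) [IsFiniteMeasure π]
    (hr1 : ∀ᵐ θ ∂π, ∫⁻ x, r θ x ∂P₀ ≤ 1) {B : Set Θ} (hB : MeasurableSet B) (hB0 : π B ≠ 0)
    {s : ℝ≥0∞} (hs : ∀ θ ∈ B, ∫⁻ x, (r θ x)⁻¹ ∂P₀ ≤ s) (hs' : s ≠ ∞) :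
    ∀ᵐ X ∂(Measure.pi fun _ : Fin n => P₀), IsProbabilityMeasure (bayesPosterior r π X) := by
  have htop : ∀ᵐ X ∂(Measure.pi fun _ : Fin n => P₀), evidence r π X < ∞ :=
    ae_lt_top (measurable_evidence hr) (ne_top_of_le_ne_top
      (by simp only [one_pow, one_mul]; exact measure_ne_top π univ) (lintegral_evidence_le hr hr1))
  have hzero : ∀ᵐ X ∂(Measure.pi fun _ : Fin n => P₀), evidence r π X ≠ 0 := by
    have hlim : Tendsto (fun c : ℕ => (c : ℝ≥0∞)⁻¹ * s ^ n) atTop (𝓝 0) := by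
      simpa only [zero_mul] using ENNReal.Tendsto.mul_const ENNReal.tendsto_inv_nat_nhds_zero
        (Or.inr (ENNReal.pow_ne_top hs'))
    rw [ae_iff]
    refine le_antisymm (ge_of_tendsto hlim ?_) zero_le
    filter_upwards [eventually_ne_atTop 0] with c hc
    refine (measure_mono fun X hX => ?_).trans (pi_evidence_lt_le hr hfin hB hB0 hs
      (Nat.cast_ne_zero.2 hc) (ENNReal.natCast_ne_top c))
    rw [mem_ofPred_eq, not_not] at hX
    rw [mem_ofPred_eq, hX, mul_zero]
    exact pos_iff_ne_zero.2 hB0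
  filter_upwards [htop, hzero] with X h h0
  exact isProbabilityMeasure_bayesPosterior h0 h.ne

theorem lintegral_bayesPosterior_le (hr : Measurable (Function.uncurry r))
    (hfin : ∀ᵐ x ∂P₀, ∀ θ, r θ x ≠ ∞) [IsProbabilityMeasure π]
    (hr1 : ∀ᵐ θ ∂π, ∫⁻ x, r θ x ∂P₀ ≤ 1) {B : Set Θ} (hB : MeasurableSet B) (hB0 : π B ≠ 0)
    {s c : ℝ≥0∞} (hs : ∀ θ ∈ B, ∫⁻ x, (r θ x)⁻¹ ∂P₀ ≤ s) (hc0 : c ≠ 0) (hc : c ≠ ∞)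
    (hV : MeasurableSet V) (hU : ∀ i ∈ I, MeasurableSet (U i))
    (hum : ∀ i ∈ I, Measurable (u i)) (hu : ∀ᵐ x ∂P₀, ∀ i ∈ I, ∀ θ ∈ U i, r θ x ≤ u i x)
    (hS : S ⊆ V ∪ ⋃ i ∈ I, U i) {t : ℝ} (ht0 : 0 ≤ t) (ht1 : t ≤ 1) :
    ∫⁻ X, bayesPosterior r π X S ∂(Measure.pi fun _ : Fin n => P₀)
      ≤ c⁻¹ * s ^ n + c / π B * π V
        + ∑ i ∈ I, (c / π B) ^ t * (∫⁻ x, u i x ^ t ∂P₀) ^ n := by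
  set E : Set (Fin n → 𝓧) := {X | c * evidence r π X < π B}
  have hE : MeasurableSet E :=
    measurableSet_lt ((measurable_evidence hr).const_mul c) measurable_const
  have hpt : ∀ᵐ X ∂(Measure.pi fun _ : Fin n => P₀), bayesPosterior r π X S
      ≤ E.indicator 1 X + (c / π B * evidence r (π.restrict V) X
        + ∑ i ∈ I, (c / π B) ^ t * ∏ j, u i (X j) ^ t) := by
    filter_upwards [ae_pi_forall fun _ => hu] with X hX
    by_cases hXE : X ∈ E
    · rw [indicator_of_mem hXE, Pi.one_apply]
      exact (bayesPosterior_le_one S).trans le_self_add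
    · have hev : (c / π B)⁻¹ ≤ evidence r π X := by
        rw [ENNReal.inv_div (Or.inl (measure_ne_top π B)) (Or.inl hB0)]
        exact ENNReal.div_le_of_le_mul' (not_lt.1 hXE)
      rw [indicator_of_notMem hXE, zero_add]
      exact bayesPosterior_le_add_sum hev hV hU hX hS ht0 ht1
  have hmV : Measurable fun X : Fin n → 𝓧 => evidence r (π.restrict V) X := measurable_evidence hr
  have hmU : ∀ i ∈ I, Measurable fun X : Fin n → 𝓧 => ∏ j, u i (X j) ^ t := fun i hi =>
    Finset.measurable_prod _ fun j _ => ((hum i hi).comp (measurable_pi_apply j)).pow_const t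
  refine (lintegral_mono_ae hpt).trans ?_
  rw [lintegral_add_left (measurable_one.indicator hE), lintegral_indicator_one hE,
    lintegral_add_left (hmV.const_mul _), lintegral_const_mul _ hmV, add_assoc,
    lintegral_finsetSum' _ fun i hi => ((hmU i hi).const_mul _).aemeasurable]
  refine add_le_add (pi_evidence_lt_le hr hfin hB hB0 hs hc0 hc)
    (add_le_add ?_ (Finset.sum_le_sum fun i hi => ?_))
  · gcongr
    simpa only [one_pow, one_mul, Measure.restrict_apply_univ] using
      lintegral_evidence_le (n := n) (π := π.restrict V) hr (ae_restrict_of_ae hr1)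
  · rw [lintegral_const_mul _ (hmU i hi), lintegral_pi_prod ((hum i hi).pow_const t)]

end Posterior

/-! ### Measurability on a countable disjoint union -/

section Sigma

variable {ι : Type*} {β : ι → Type*} [∀ i, MeasurableSpace (β i)] {γ δ : Type*}
  [MeasurableSpace γ] [MeasurableSpace δ]

theorem measurableSet_sigma_iff {S : Set (Sigma β)} :
    MeasurableSet S ↔ ∀ i, MeasurableSet (Sigma.mk i ⁻¹' S) := by
  rw [Sigma.instMeasurableSpace, MeasurableSpace.measurableSet_iInf]
  rfl

theorem measurableEmbedding_sigmaMk (i : ι) : MeasurableEmbedding (Sigma.mk i : β i → Sigma β) where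
  injective := sigma_mk_injective
  measurable := fun _ hS => measurableSet_sigma_iff.1 hS i
  measurableSet_image' := by
    intro s hs
    refine measurableSet_sigma_iff.2 fun j => ?_
    rcases eq_or_ne i j with rfl | hij
    · rwa [preimage_image_eq _ sigma_mk_injective]
    · rw [preimage_image_sigmaMk_of_ne hij.symm]
      exact MeasurableSet.empty

theorem measurable_sigma_prod [Countable ι] {f : Sigma β × γ → δ}
    (hf : ∀ i, Measurable fun z : β i × γ => f (⟨i, z.1⟩, z.2)) : Measurable f := by
  intro s hs
  have hunion : f ⁻¹' s = ⋃ i, Prod.map (Sigma.mk i) id ''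
      ((fun z : β i × γ => f (⟨i, z.1⟩, z.2)) ⁻¹' s) := by
    ext ⟨⟨i, b⟩, c⟩
    simp only [mem_preimage, mem_iUnion, mem_image]
    refine ⟨fun h => ⟨i, (b, c), h, rfl⟩, ?_⟩
    rintro ⟨j, ⟨b', c'⟩, h, h'⟩
    rwa [← h']
  rw [hunion]
  exact MeasurableSet.iUnion fun i =>
    ((measurableEmbedding_sigmaMk i).prodMap MeasurableEmbedding.id).measurableSet_image' (hf i hs)

end Sigma

/-! ### Polygons as a statistical model -/

theorem measurableSet_leftHalf (k j : ℕ) : MeasurableSet (leftHalf k j) := by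
  unfold leftHalf bin
  measurability

theorem measurableSet_rightHalf (k j : ℕ) : MeasurableSet (rightHalf k j) := by
  unfold rightHalf bin
  measurability

theorem measurable_indicator_snd {α β : Type*} [MeasurableSpace α] [MeasurableSpace β]
    {g : α → β → ℝ} (hg : Measurable (Function.uncurry g)) {s : Set β} (hs : MeasurableSet s) :
    Measurable fun z : α × β => s.indicator (g z.1) z.2 :=
  hg.indicator (measurable_snd hs)

theorem measurable_polygon (k : ℕ+) : Measurable (Function.uncurry (polygon k)) := by
  have hconst : ∀ j : Fin k,
      Measurable (Function.uncurry fun (w : Fin k → ℝ) (_ : ℝ) => w j * (k : ℝ)) := by fun_prop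
  refine ((measurable_indicator_snd (hconst ⟨0, k.pos⟩) (measurableSet_leftHalf k 0)).add
    (Finset.measurable_sum _ fun j _ => ?_)).add
    (measurable_indicator_snd (hconst ⟨k - 1, Nat.sub_lt k.pos Nat.one_pos⟩)
      (measurableSet_rightHalf k _))
  exact measurable_indicator_snd (g := fun (w : Fin k → ℝ) y =>
      ((k : ℝ) * (mid k (j + 1) - y) * w ⟨j, by omega⟩
        + (k : ℝ) * (y - mid k j) * w ⟨j + 1, by omega⟩) * k) (by fun_prop)
    ((measurableSet_rightHalf k j).union (measurableSet_leftHalf k (j + 1)))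

theorem measurable_density : Measurable (Function.uncurry Param.density) :=
  measurable_sigma_prod measurable_polygon

instance : IsProbabilityMeasure lam := ⟨by simp [lam]⟩

theorem ae_lam_mem : ∀ᵐ x ∂lam, x ∈ Icc (0 : ℝ) 1 := ae_restrict_mem measurableSet_Icc

/-- The law of a single observation with density `f₀` on `[0, 1]`. -/
noncomputable def obsLaw (f₀ : ℝ → ℝ) : Measure ℝ := lam.withDensity fun x => ENNReal.ofReal (f₀ x)

/-- The ratio of the density of a parameter to `f₀`: the density of the parameter with respect to
`obsLaw f₀`, wherever `f₀` is positive. -/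
noncomputable def densityRatio (f₀ : ℝ → ℝ) (θ : Param) (x : ℝ) : ℝ≥0∞ :=
  ENNReal.ofReal (θ.density x) / ENNReal.ofReal (f₀ x)

/-- The chi-square ball around `f₀`, given by `∫ f₀ ^ 2 / θ.density ≤ s`: its radius is `s - 1`. -/
def chiSqBall (f₀ : ℝ → ℝ) (s : ℝ≥0∞) : Set Param :=
  {θ | ∫⁻ x, (densityRatio f₀ θ x)⁻¹ ∂obsLaw f₀ ≤ s}

variable {f₀ : ℝ → ℝ} {n : ℕ}

theorem isProbabilityMeasure_obsLaw (hd : IsDensity f₀) : IsProbabilityMeasure (obsLaw f₀) :=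
  ⟨by rw [obsLaw, withDensity_apply _ MeasurableSet.univ, Measure.restrict_univ, hd.2]⟩

theorem sampleLaw_eq_pi (f₀ : ℝ → ℝ) (n : ℕ) :
    sampleLaw f₀ n = Measure.pi fun _ => obsLaw f₀ := rfl

theorem isProbabilityMeasure_sampleLaw (hd : IsDensity f₀) (n : ℕ) :
    IsProbabilityMeasure (sampleLaw f₀ n) := by
  have := isProbabilityMeasure_obsLaw hd
  rw [sampleLaw_eq_pi]
  infer_instance

theorem ae_obsLaw_mem : ∀ᵐ x ∂obsLaw f₀, x ∈ Icc (0 : ℝ) 1 :=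
  (withDensity_absolutelyContinuous _ _).ae_le ae_lam_mem

theorem ae_obsLaw_pos (hf : Measurable f₀) : ∀ᵐ x ∂obsLaw f₀, 0 < f₀ x := by
  rw [obsLaw, ae_withDensity_iff hf.ennreal_ofReal]
  exact ae_of_all _ fun x hx => ENNReal.ofReal_pos.1 (pos_iff_ne_zero.2 hx)

theorem lintegral_obsLaw (hf : Measurable f₀) {h : ℝ → ℝ≥0∞} (hh : Measurable h) :
    ∫⁻ x, h x ∂obsLaw f₀ = ∫⁻ x, ENNReal.ofReal (f₀ x) * h x ∂lam :=
  lintegral_withDensity_eq_lintegral_mul _ hf.ennreal_ofReal hh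

theorem measurable_densityRatio (hf : Measurable f₀) :
    Measurable (Function.uncurry (densityRatio f₀)) :=
  measurable_density.ennreal_ofReal.div (hf.comp measurable_snd).ennreal_ofReal

theorem ae_densityRatio_ne_top (hf : Measurable f₀) :
    ∀ᵐ x ∂obsLaw f₀, ∀ θ, densityRatio f₀ θ x ≠ ∞ := by
  filter_upwards [ae_obsLaw_pos hf] with x hx θ
  exact ENNReal.div_ne_top ENNReal.ofReal_ne_top (ENNReal.ofReal_pos.2 hx).ne'

theorem lintegral_densityRatio_le (hf : Measurable f₀) (θ : Param) :
    ∫⁻ x, densityRatio f₀ θ x ∂obsLaw f₀ ≤ ∫⁻ x, ENNReal.ofReal (θ.density x) ∂lam := by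
  rw [lintegral_obsLaw hf (measurable_densityRatio hf).of_uncurry_left]
  exact lintegral_mono fun x => ENNReal.mul_div_le

theorem measurableSet_chiSqBall (hf : Measurable f₀) (hd : IsDensity f₀) (s : ℝ≥0∞) :
    MeasurableSet (chiSqBall f₀ s) :=
  have := isProbabilityMeasure_obsLaw hd
  measurableSet_le (measurable_densityRatio hf).inv.lintegral_prod_right measurable_const

/-- The integral on the right is the Hellinger affinity of `f₀` and `u`. -/
theorem lintegral_obsLaw_div_rpow_half_le (hf : Measurable f₀) {u : ℝ → ℝ} (hu : Measurable u) :
    ∫⁻ x, (ENNReal.ofReal (u x) / ENNReal.ofReal (f₀ x)) ^ (1 / 2 : ℝ) ∂obsLaw f₀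
      ≤ ∫⁻ x, ENNReal.ofReal √(u x * f₀ x) ∂lam := by
  rw [lintegral_obsLaw hf (by fun_prop)]
  refine lintegral_mono fun x => ?_
  rcases le_or_gt (f₀ x) 0 with hf0 | hf0
  · simp only [ENNReal.ofReal_of_nonpos hf0, zero_mul, zero_le]
  rcases le_or_gt (u x) 0 with hu0 | hu0
  · simp [ENNReal.ofReal_of_nonpos hu0]
  rw [← ENNReal.ofReal_div_of_pos hf0, ENNReal.ofReal_rpow_of_nonneg (by positivity) (by norm_num),
    ← ENNReal.ofReal_mul hf0.le, ← Real.sqrt_eq_rpow, Real.sqrt_div hu0.le, Real.sqrt_mul hu0.le,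
    ← mul_div_assoc, mul_comm, mul_div_assoc, Real.div_sqrt]

theorem postDist_eq_bayesPosterior (π : Measure Param) (X : Fin n → ℝ) :
    postDist π X = bayesPosterior (fun θ x => ENNReal.ofReal (θ.density x)) π X := rfl

theorem ae_postDist_eq (hf : Measurable f₀) (hd : IsDensity f₀) (π : Measure Param) (n : ℕ) :
    ∀ᵐ X ∂(sampleLaw f₀ n), postDist π X = bayesPosterior (densityRatio f₀) π X := by
  have := isProbabilityMeasure_obsLaw hd
  rw [sampleLaw_eq_pi]
  filter_upwards [ae_pi_forall fun _ => ae_obsLaw_pos hf] with X hX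
  have hdiv := bayesPosterior_div (r := fun (θ : Param) x => ENNReal.ofReal (θ.density x)) (π := π)
    (g := fun x => ENNReal.ofReal (f₀ x)) (fun i => (ENNReal.ofReal_pos.2 (hX i)).ne')
    fun _ => ENNReal.ofReal_ne_top
  exact (postDist_eq_bayesPosterior π X).trans hdiv.symm

theorem lintegral_postDist_le (hf : Measurable f₀) (hd : IsDensity f₀) {π : Measure Param}
    [IsProbabilityMeasure π] (hπ : ∀ᵐ θ ∂π, ∫⁻ x, ENNReal.ofReal (θ.density x) ∂lam ≤ 1)
    {s c : ℝ≥0∞} (hB0 : π (chiSqBall f₀ s) ≠ 0) (hc0 : c ≠ 0) (hc : c ≠ ∞) {ι : Type*}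
    {I : Finset ι} {V S : Set Param} {U : ι → Set Param} {u : ι → ℝ → ℝ} (hV : MeasurableSet V)
    (hU : ∀ i ∈ I, MeasurableSet (U i)) (hum : ∀ i ∈ I, Measurable (u i))
    (hu : ∀ i ∈ I, ∀ θ ∈ U i, ∀ x ∈ Icc (0 : ℝ) 1, θ.density x ≤ u i x)
    (hS : S ⊆ V ∪ ⋃ i ∈ I, U i) :
    ∫⁻ X, postDist π X S ∂(sampleLaw f₀ n)
      ≤ c⁻¹ * s ^ n + c / π (chiSqBall f₀ s) * π V + ∑ i ∈ I,
        (c / π (chiSqBall f₀ s)) ^ (1 / 2 : ℝ) *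
          (∫⁻ x, ENNReal.ofReal √(u i x * f₀ x) ∂lam) ^ n := by
  have := isProbabilityMeasure_obsLaw hd
  have hdom : ∀ᵐ x ∂obsLaw f₀, ∀ i ∈ I, ∀ θ ∈ U i,
      densityRatio f₀ θ x ≤ ENNReal.ofReal (u i x) / ENNReal.ofReal (f₀ x) := by
    filter_upwards [ae_obsLaw_mem] with x hx i hi θ hθ
    exact ENNReal.div_le_div_right (ENNReal.ofReal_le_ofReal (hu i hi θ hθ x hx)) _
  calc ∫⁻ X, postDist π X S ∂(sampleLaw f₀ n)
      = ∫⁻ X, bayesPosterior (densityRatio f₀) π X S ∂(sampleLaw f₀ n) :=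
        lintegral_congr_ae ((ae_postDist_eq hf hd π n).mono fun X hX => by simp only [hX])
    _ ≤ _ := lintegral_bayesPosterior_le (measurable_densityRatio hf) (ae_densityRatio_ne_top hf)
        (hπ.mono fun θ => (lintegral_densityRatio_le hf θ).trans) (measurableSet_chiSqBall hf hd s)
        hB0 (fun _ hθ => hθ) hc0 hc hV hU
        (fun i hi => (hum i hi).ennreal_ofReal.div hf.ennreal_ofReal) hdom hS
        (by norm_num : (0 : ℝ) ≤ 1 / 2) (by norm_num)
    _ ≤ _ := by
        refine add_le_add_right (Finset.sum_le_sum fun i hi => ?_) _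
        refine mul_le_mul_right (pow_le_pow_left' ?_ n) _
        exact lintegral_obsLaw_div_rpow_half_le hf (hum i hi)

theorem ae_isProbabilityMeasure_postDist (hf : Measurable f₀) (hd : IsDensity f₀)
    {π : Measure Param} [IsFiniteMeasure π]
    (hπ : ∀ᵐ θ ∂π, ∫⁻ x, ENNReal.ofReal (θ.density x) ∂lam ≤ 1) {s : ℝ≥0∞} (hs : s ≠ ∞)
    (hB0 : π (chiSqBall f₀ s) ≠ 0) (n : ℕ) :
    ∀ᵐ X ∂(sampleLaw f₀ n), IsProbabilityMeasure (postDist π X) := by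
  have := isProbabilityMeasure_obsLaw hd
  have hratio : ∀ᵐ X ∂(sampleLaw f₀ n),
      IsProbabilityMeasure (bayesPosterior (densityRatio f₀) π X) := by
    rw [sampleLaw_eq_pi]
    exact ae_isProbabilityMeasure_bayesPosterior (measurable_densityRatio hf)
      (ae_densityRatio_ne_top hf)
      (hπ.mono fun θ => (lintegral_densityRatio_le hf θ).trans) (measurableSet_chiSqBall hf hd s)
      hB0 (fun _ hθ => hθ) hs
  filter_upwards [ae_postDist_eq hf hd π n, hratio] with X hX h
  rwa [hX]

/-! ### The shape of a polygon -/

section Polygon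

variable {k : ℕ+} {i j : ℕ} {x : ℝ} {w v : Fin k → ℝ}

theorem natCast_pnat_pos (k : ℕ+) : (0 : ℝ) < k := mod_cast k.pos

theorem mid_lt_mid : mid k i < mid k j ↔ i < j := by
  simp only [mid, div_lt_div_iff_of_pos_right (natCast_pnat_pos k), add_lt_add_iff_right,
    Nat.cast_lt]

theorem mid_le_mid : mid k i ≤ mid k j ↔ i ≤ j := by
  rw [← not_lt, mid_lt_mid, not_lt]

theorem mid_zero (k : ℕ) : mid k 0 = 1 / k / 2 := by
  rw [mid, Nat.cast_zero]; ring

theorem mid_succ (k j : ℕ) : mid k (j + 1) = mid k j + 1 / k := by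
  rw [mid, mid, Nat.cast_succ]; ring

theorem mid_last (k : ℕ+) : mid k (k - 1) = 1 - 1 / k / 2 := by
  rw [mid, Nat.cast_pred k.pos]; field_simp; ring

theorem mid_nonneg (k j : ℕ) : 0 ≤ mid k j := by unfold mid; positivity

theorem mid_mem_Icc (hj : j < k) : mid k j ∈ Icc (0 : ℝ) 1 := by
  refine ⟨mid_nonneg k j, (mid_le_mid.2 (Nat.le_sub_one_of_lt hj)).trans ?_⟩
  rw [mid_last]
  exact sub_le_self _ (by positivity)

theorem leftHalf_zero (k : ℕ+) : leftHalf k 0 = Icc 0 (mid k 0) := by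
  have hmid : mid k 0 ≤ 1 / k := by rw [mid_zero]; exact half_le_self (by positivity)
  rw [leftHalf, bin, if_pos rfl, ← Ici_inter_Iic, inter_assoc, Iic_inter_Iic,
    min_eq_right hmid, Ici_inter_Iic]

theorem leftHalf_succ (k : ℕ+) (j : ℕ) :
    leftHalf k (j + 1) = Ioc (((j : ℝ) + 1) / k) (mid k (j + 1)) := by
  have hmid : mid k (j + 1) ≤ (((j + 1 : ℕ) : ℝ) + 1) / k := by
    unfold mid; gcongr; norm_num
  rw [leftHalf, bin, if_neg j.succ_ne_zero, ← Ioi_inter_Iic, inter_assoc, Iic_inter_Iic,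
    min_eq_right hmid, Ioi_inter_Iic, Nat.cast_succ]

theorem rightHalf_eq (k : ℕ+) (j : ℕ) : rightHalf k j = Ioc (mid k j) (((j : ℝ) + 1) / k) := by
  have hmid : (j : ℝ) / k < mid k j := by
    unfold mid; have := natCast_pnat_pos k; gcongr; linarith
  have h0 : (0 : ℝ) ≤ (j : ℝ) / k := by positivity
  ext x
  unfold rightHalf bin
  split_ifs with hj
  · subst hj
    simp only [Nat.cast_zero, zero_add, mem_inter_iff, mem_Icc, mem_Ioi, mem_Ioc] at *
    exact ⟨fun h => ⟨h.2, h.1.2⟩, fun h => ⟨⟨by linarith, h.2⟩, h.1⟩⟩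
  · simp only [mem_inter_iff, mem_Ioc, mem_Ioi]
    exact ⟨fun h => ⟨h.2, h.1.2⟩, fun h => ⟨⟨hmid.trans h.1, h.2⟩, h.1⟩⟩

theorem rightHalf_union_leftHalf (k : ℕ+) (j : ℕ) :
    rightHalf k j ∪ leftHalf k (j + 1) = Ioc (mid k j) (mid k (j + 1)) := by
  rw [rightHalf_eq, leftHalf_succ, Ioc_union_Ioc_eq_Ioc]
  · unfold mid; gcongr; norm_num
  · rw [mid, div_le_div_iff_of_pos_right (natCast_pnat_pos k), Nat.cast_succ]; linarith

theorem rightHalf_last (k : ℕ+) : rightHalf k (k - 1) = Ioc (mid k (k - 1)) 1 := by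
  rw [rightHalf_eq, Nat.cast_pred k.pos, sub_add_cancel, div_self (natCast_pnat_pos k).ne']

theorem polygon_eq (k : ℕ+) (w : Fin k → ℝ) (x : ℝ) :
    polygon k w x = (Icc 0 (mid k 0)).indicator (fun _ => w ⟨0, k.pos⟩ * k) x
      + ∑ j : Fin ((k : ℕ) - 1), (Ioc (mid k j) (mid k (j + 1))).indicator
        (fun y => ((k : ℝ) * (mid k (j + 1) - y) * w ⟨j, by omega⟩
          + (k : ℝ) * (y - mid k j) * w ⟨j + 1, by omega⟩) * k) x
      + (Ioc (mid k (k - 1)) 1).indicator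
        (fun _ => w ⟨k - 1, Nat.sub_lt k.pos Nat.one_pos⟩ * k) x := by
  simp only [polygon, leftHalf_zero, rightHalf_union_leftHalf, rightHalf_last]

theorem polygon_of_le_mid_zero (hx : x ∈ Icc 0 (mid k 0)) :
    polygon k w x = k * w ⟨0, k.pos⟩ := by
  have hmid (j : ℕ) : x ≤ mid k j := hx.2.trans (mid_le_mid.2 j.zero_le)
  rw [polygon_eq, indicator_of_mem hx, Finset.sum_eq_zero fun j _ =>
      indicator_of_notMem (fun h => h.1.not_ge (hmid _)) _,
    indicator_of_notMem fun h => h.1.not_ge (hmid _)]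
  ring

theorem polygon_of_mid_last_lt (hx : x ∈ Ioc (mid k (k - 1)) 1) :
    polygon k w x = k * w ⟨k - 1, Nat.sub_lt k.pos Nat.one_pos⟩ := by
  have hmid {j : ℕ} (hj : j ≤ k - 1) : mid k j < x := (mid_le_mid.2 hj).trans_lt hx.1
  rw [polygon_eq, indicator_of_mem hx, Finset.sum_eq_zero fun j _ =>
      indicator_of_notMem (fun h => h.2.not_gt (hmid (by omega))) _,
    indicator_of_notMem fun h => h.2.not_gt (hmid (Nat.zero_le _))]
  ring

theorem polygon_of_mem_Ioc {j : ℕ} (hj : j + 1 < k) (hx : x ∈ Ioc (mid k j) (mid k (j + 1))) :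
    polygon k w x = k * (k * (mid k (j + 1) - x) * w ⟨j, j.lt_succ_self.trans hj⟩
      + k * (x - mid k j) * w ⟨j + 1, hj⟩) := by
  have hfirst : x ∉ Icc 0 (mid k 0) := fun h =>
    (hx.1.trans_le h.2).not_ge (mid_le_mid.2 j.zero_le)
  have hlast : x ∉ Ioc (mid k (k - 1)) 1 := fun h =>
    (h.1.trans_le hx.2).not_ge (mid_le_mid.2 (by omega))
  rw [polygon_eq, indicator_of_notMem hfirst, indicator_of_notMem hlast,
    Finset.sum_eq_single ⟨j, by omega⟩]
  · rw [indicator_of_mem hx]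
    ring
  · refine fun i _ hij => indicator_of_notMem (fun h => hij (Fin.ext ?_)) _
    have hle := mid_lt_mid.1 (h.1.trans_le hx.2)
    have hge := mid_lt_mid.1 (hx.1.trans_le h.2)
    simp only
    omega
  · simp

theorem exists_mem_Ioc_mid (h0 : mid k 0 < x) (h1 : x ≤ mid k (k - 1)) :
    ∃ j : ℕ, j + 1 < k ∧ x ∈ Ioc (mid k j) (mid k (j + 1)) := by
  have hk := natCast_pnat_pos k
  have hpos : 0 < x * k - 1 / 2 := by
    rw [mid_zero, div_div, div_lt_iff₀ (by positivity)] at h0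
    linarith
  obtain ⟨j, hj⟩ := Nat.exists_eq_succ_of_ne_zero (Nat.ceil_pos.2 hpos).ne'
  have hlt := Nat.ceil_lt_add_one hpos.le
  have hle := Nat.le_ceil (x * k - 1 / 2)
  rw [hj, Nat.cast_succ] at hlt hle
  have hjx : mid k j < x := by rw [mid, div_lt_iff₀ hk]; linarith
  have := mid_lt_mid.1 (hjx.trans_le h1)
  refine ⟨j, by omega, hjx, ?_⟩
  rw [mid, le_div_iff₀ hk, Nat.cast_succ]
  linarith

theorem exists_polygon_eq (hx : x ∈ Icc (0 : ℝ) 1) :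
    ∃ i j : Fin k, ∃ a b : ℝ, 0 ≤ a ∧ 0 ≤ b ∧ a + b = 1 ∧
      |mid k i - x| ≤ 1 / k ∧ |mid k j - x| ≤ 1 / k ∧
      (∀ w : Fin k → ℝ, polygon k w x = k * (a * w i + b * w j)) ∧
      (a * mid k i + b * mid k j = x ∨
        i = j ∧ ∃ z ∈ ({0, 1} : Set ℝ), |mid k i - z| ≤ 1 / k ∧ |x - z| ≤ 1 / k) := by
  have hinv : 0 < 1 / (k : ℝ) := one_div_pos.2 (natCast_pnat_pos k)
  have hkk : (k : ℝ) * (1 / k) = 1 := by field_simp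
  have hm0 := mid_zero k
  have hm1 := mid_last k
  rcases le_or_gt x (mid k 0) with h0 | h0
  · have hdist : |mid k 0 - x| ≤ 1 / k := abs_le.2 ⟨by linarith, by linarith [hx.1]⟩
    refine ⟨⟨0, k.pos⟩, ⟨0, k.pos⟩, 1, 0, zero_le_one, le_rfl, add_zero 1, hdist, hdist,
      fun w => ?_, .inr ⟨rfl, 0, by simp, abs_le.2 ⟨by linarith, by linarith⟩,
        abs_le.2 ⟨by linarith [hx.1], by linarith⟩⟩⟩
    rw [polygon_of_le_mid_zero ⟨hx.1, h0⟩, one_mul, zero_mul, add_zero]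
  rcases lt_or_ge (mid k (k - 1)) x with h1 | h1
  · have hl : (k : ℕ) - 1 < k := Nat.sub_lt k.pos Nat.one_pos
    have hdist : |mid k (k - 1) - x| ≤ 1 / k := abs_le.2 ⟨by linarith [hx.2], by linarith⟩
    refine ⟨⟨_, hl⟩, ⟨_, hl⟩, 1, 0, zero_le_one, le_rfl, add_zero 1, hdist, hdist,
      fun w => ?_, .inr ⟨rfl, 1, by simp, abs_le.2 ⟨by linarith, by linarith⟩,
        abs_le.2 ⟨by linarith, by linarith [hx.2]⟩⟩⟩
    rw [polygon_of_mid_last_lt ⟨h1, hx.2⟩, one_mul, zero_mul, add_zero]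
  · obtain ⟨j, hj, hjx⟩ := exists_mem_Ioc_mid h0 h1
    have hms := mid_succ k j
    have hl : 0 ≤ x - mid k j := by linarith [hjx.1]
    have hr : 0 ≤ mid k (j + 1) - x := by linarith [hjx.2]
    refine ⟨⟨j, by omega⟩, ⟨j + 1, hj⟩, k * (mid k (j + 1) - x), k * (x - mid k j),
      by positivity, by positivity, ?_, abs_le.2 ⟨by linarith, by linarith⟩,
      abs_le.2 ⟨by linarith, by linarith⟩, fun w => polygon_of_mem_Ioc hj hjx, .inl ?_⟩
    · rw [hms]; linear_combination hkk
    · rw [hms]; linear_combination x * hkk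

theorem polygon_mono (h : w ≤ v) (hx : x ∈ Icc (0 : ℝ) 1) : polygon k w x ≤ polygon k v x := by
  obtain ⟨i, j, a, b, ha, hb, -, -, -, hp, -⟩ := exists_polygon_eq hx
  rw [hp, hp]
  gcongr
  exacts [h i, h j]

theorem polygon_const (c : ℝ) (hx : x ∈ Icc (0 : ℝ) 1) : polygon k (fun _ => c) x = k * c := by
  obtain ⟨i, j, a, b, -, -, hab, -, -, hp, -⟩ := exists_polygon_eq hx
  rw [hp, ← add_mul, hab, one_mul]

theorem polygon_add (w v : Fin k → ℝ) (hx : x ∈ Icc (0 : ℝ) 1) :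
    polygon k (fun j => w j + v j) x = polygon k w x + polygon k v x := by
  obtain ⟨i, j, a, b, -, -, -, -, -, hp, -⟩ := exists_polygon_eq hx
  rw [hp, hp, hp]
  ring

theorem polygon_div (w : Fin k → ℝ) (c : ℝ) (hx : x ∈ Icc (0 : ℝ) 1) :
    polygon k (fun j => w j / c) x = polygon k w x / c := by
  obtain ⟨i, j, a, b, -, -, -, -, -, hp, -⟩ := exists_polygon_eq hx
  rw [hp, hp]
  ring

theorem polygon_nonneg (h : ∀ j, 0 ≤ w j) (hx : x ∈ Icc (0 : ℝ) 1) : 0 ≤ polygon k w x := by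
  simpa only [polygon_const 0 hx, mul_zero] using polygon_mono (w := fun _ => 0) h hx

theorem integrable_polygon (k : ℕ+) (w : Fin k → ℝ) : Integrable (polygon k w) lam := by
  refine .of_bound (measurable_polygon k).of_uncurry_left.aestronglyMeasurable
    (k * ∑ j, |w j|) ?_
  filter_upwards [ae_lam_mem] with x hx
  have hw (i) : |w i| ≤ ∑ j, |w j| :=
    Finset.single_le_sum (fun j _ => abs_nonneg (w j)) (Finset.mem_univ i)
  have hle := polygon_mono (v := fun _ => ∑ j, |w j|) (fun i => (abs_le.1 (hw i)).2) hx
  have hge := polygon_mono (w := fun _ => -∑ j, |w j|) (fun i => (abs_le.1 (hw i)).1) hx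
  rw [polygon_const _ hx] at hle hge
  exact abs_le.2 ⟨by linarith, hle⟩

theorem integral_indicator_Ioc_lam {a b : ℝ} (ha : 0 ≤ a) (hab : a ≤ b) (hb : b ≤ 1)
    (g : ℝ → ℝ) : ∫ x, (Ioc a b).indicator g x ∂lam = ∫ x in a..b, g x := by
  rw [integral_indicator measurableSet_Ioc, lam, Measure.restrict_restrict measurableSet_Ioc,
    inter_eq_left.2, intervalIntegral.integral_of_le hab]
  exact fun x hx => ⟨ha.trans hx.1.le, hx.2.trans hb⟩

theorem polygon_ae_eq (k : ℕ+) (w : Fin k → ℝ) :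
    polygon k w =ᵐ[lam] fun x => (Ioc 0 (mid k 0)).indicator (fun _ => w ⟨0, k.pos⟩ * k) x
      + ∑ j : Fin ((k : ℕ) - 1), (Ioc (mid k j) (mid k (j + 1))).indicator
        (fun y => ((k : ℝ) * (mid k (j + 1) - y) * w ⟨j, by omega⟩
          + (k : ℝ) * (y - mid k j) * w ⟨j + 1, by omega⟩) * k) x
      + (Ioc (mid k (k - 1)) 1).indicator
        (fun _ => w ⟨k - 1, Nat.sub_lt k.pos Nat.one_pos⟩ * k) x := by
  have hIoc : Ioc 0 (mid k 0) =ᵐ[lam] Icc 0 (mid k 0) := ae_restrict_of_ae Ioc_ae_eq_Icc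
  filter_upwards [indicator_ae_eq_of_ae_eq_set (f := fun _ => w ⟨0, k.pos⟩ * (k : ℝ)) hIoc]
    with x hx
  rw [polygon_eq, hx]

theorem integral_segment {k : ℝ} (hk : k ≠ 0) (m a b : ℝ) :
    ∫ y in m..(m + 1 / k), (k * (m + 1 / k - y) * a + k * (y - m) * b) * k = (a + b) / 2 := by
  have hlin : (fun y : ℝ => (k * (m + 1 / k - y) * a + k * (y - m) * b) * k)
      = fun y => k ^ 2 * (b - a) * y + k ^ 2 * ((m + 1 / k) * a - m * b) := by
    ext y; ring
  rw [hlin, intervalIntegral.integral_add (Continuous.intervalIntegrable (by fun_prop) _ _)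
      (Continuous.intervalIntegrable (by fun_prop) _ _),
    intervalIntegral.integral_const_mul, integral_id, intervalIntegral.integral_const, smul_eq_mul]
  field_simp
  ring

theorem integral_polygon_cell (hj : j + 1 < k) (a b : ℝ) :
    ∫ x, (Ioc (mid k j) (mid k (j + 1))).indicator
      (fun y => ((k : ℝ) * (mid k (j + 1) - y) * a + (k : ℝ) * (y - mid k j) * b) * k) x ∂lam
      = (a + b) / 2 := by
  rw [integral_indicator_Ioc_lam (mid_nonneg k j) (mid_le_mid.2 (Nat.le_succ _))
    (mid_mem_Icc hj).2, mid_succ, integral_segment (natCast_pnat_pos k).ne']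

theorem half_add_sum_half_add_half (W : ℕ → ℝ) (m : ℕ) :
    W 0 / 2 + ∑ j ∈ Finset.range m, (W j + W (j + 1)) / 2 + W m / 2
      = ∑ j ∈ Finset.range (m + 1), W j := by
  have hlast := Finset.sum_range_succ W m
  have hfirst := Finset.sum_range_succ' W m
  rw [← Finset.sum_div, Finset.sum_add_distrib]
  linarith

theorem integral_polygon (k : ℕ+) (w : Fin k → ℝ) : ∫ x, polygon k w x ∂lam = ∑ j, w j := by
  have hind (a b : ℝ) {g : ℝ → ℝ} (hg : Continuous g) :
      Integrable (fun x => (Ioc a b).indicator g x) lam :=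
    Integrable.indicator hg.continuousOn.integrableOn_Icc measurableSet_Ioc
  have hsum_int := integrable_finsetSum (μ := lam) Finset.univ
    fun (j : Fin ((k : ℕ) - 1)) _ => hind (mid k j) (mid k (j + 1))
      (g := fun y => ((k : ℝ) * (mid k (j + 1) - y) * w ⟨j, by omega⟩
        + (k : ℝ) * (y - mid k j) * w ⟨j + 1, by omega⟩) * k) (by fun_prop)
  obtain ⟨W, hW⟩ : ∃ W : ℕ → ℝ, ∀ (j : ℕ) (h : j < k), w ⟨j, h⟩ = W j :=
    ⟨fun j => if h : j < k then w ⟨j, h⟩ else 0, fun j h => by simp only [dif_pos h]⟩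
  rw [integral_congr_ae (polygon_ae_eq k w),
    integral_add ((hind _ _ continuous_const).fun_add hsum_int) (hind _ _ continuous_const),
    integral_add (hind _ _ continuous_const) hsum_int,
    integral_finsetSum _ fun j _ => hind _ _ (by fun_prop),
    Finset.sum_congr rfl fun j _ => integral_polygon_cell (Nat.add_lt_of_lt_sub j.2) _ _,
    integral_indicator_Ioc_lam le_rfl (mid_nonneg k 0) (mid_mem_Icc k.pos).2,
    integral_indicator_Ioc_lam (mid_nonneg k _)
      (mid_mem_Icc (Nat.sub_lt k.pos Nat.one_pos)).2 le_rfl,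
    intervalIntegral.integral_const, intervalIntegral.integral_const, mid_zero, mid_last,
    hW, hW, Finset.sum_congr rfl fun _ _ => by rw [hW, hW],
    Finset.sum_congr rfl fun (j : Fin k) _ => hW j j.2, ← Finset.sum_range fun j => W j,
    ← Finset.sum_range fun j => (W j + W (j + 1)) / 2, smul_eq_mul, smul_eq_mul]
  have hfirst : (1 / (k : ℝ) / 2 - 0) * (W 0 * k) = W 0 / 2 := by field_simp; ring
  have hlast : (1 - (1 - 1 / (k : ℝ) / 2)) * (W (k - 1) * k) = W (k - 1) / 2 := by
    field_simp; ring
  rw [hfirst, hlast, half_add_sum_half_add_half, Nat.sub_add_cancel k.pos]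

theorem lintegral_polygon (hw : ∀ j, 0 ≤ w j) :
    ∫⁻ x, ENNReal.ofReal (polygon k w x) ∂lam = ENNReal.ofReal (∑ j, w j) := by
  rw [← integral_polygon, ofReal_integral_eq_lintegral_ofReal (integrable_polygon k w)]
  exact ae_lam_mem.mono fun x hx => polygon_nonneg hw hx

end Polygon

/-! ### Approximation by polygons -/

section Approximation

variable {β L : ℝ} {f d : ℝ → ℝ}

theorem mul_abs_rpow_le (hβ : 0 ≤ β) (hL : 0 ≤ L) {k : ℕ+} {t : ℝ} (ht : |t| ≤ 1 / k) :
    L * |t| ^ β ≤ L * (k : ℝ) ^ (-β) := by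
  have hk := (natCast_pnat_pos k).le
  rw [Real.rpow_neg hk, ← Real.inv_rpow hk, ← one_div]
  gcongr

theorem abs_polygon_sub_le (hβ : 0 ≤ β) (hL : 0 ≤ L)
    (hd : ∀ x ∈ Icc (0 : ℝ) 1, ∀ y ∈ Icc (0 : ℝ) 1,
      |f y - f x - d x * (y - x)| ≤ L * |y - x| ^ β)
    (h0 : d 0 = 0) (h1 : d 1 = 0) (k : ℕ+) {x : ℝ} (hx : x ∈ Icc (0 : ℝ) 1) :
    |polygon k (fun j => f (mid k j) / k) x - f x| ≤ 2 * L * (k : ℝ) ^ (-β) := by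
  obtain ⟨i, j, a, b, ha, hb, hab, hi, hj, hp, hc⟩ := exists_polygon_eq (k := k) hx
  have hLk : 0 ≤ L * (k : ℝ) ^ (-β) := by positivity
  have htaylor {x y : ℝ} (hx : x ∈ Icc (0 : ℝ) 1) (hy : y ∈ Icc (0 : ℝ) 1)
      (hxy : |y - x| ≤ 1 / k) : |f y - f x - d x * (y - x)| ≤ L * (k : ℝ) ^ (-β) :=
    (hd x hx y hy).trans (mul_abs_rpow_le hβ hL hxy)
  have hval : polygon k (fun j => f (mid k j) / k) x = a * f (mid k i) + b * f (mid k j) := by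
    rw [hp]; field_simp
  rw [hval]
  rcases hc with hc | ⟨rfl, z, hz, hiz, hxz⟩
  · have hi' := htaylor hx (mid_mem_Icc i.2) hi
    have hj' := htaylor hx (mid_mem_Icc j.2) hj
    have hcombo : a * f (mid k i) + b * f (mid k j) - f x
        = a * (f (mid k i) - f x - d x * (mid k i - x))
          + b * (f (mid k j) - f x - d x * (mid k j - x)) := by
      linear_combination (f x - d x * x) * hab + d x * hc
    calc |a * f (mid k i) + b * f (mid k j) - f x|
        ≤ a * |f (mid k i) - f x - d x * (mid k i - x)|
          + b * |f (mid k j) - f x - d x * (mid k j - x)| := by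
          rw [hcombo]
          refine (abs_add_le _ _).trans_eq ?_
          rw [abs_mul, abs_mul, abs_of_nonneg ha, abs_of_nonneg hb]
      _ ≤ a * (L * (k : ℝ) ^ (-β)) + b * (L * (k : ℝ) ^ (-β)) := by gcongr
      _ ≤ 2 * L * (k : ℝ) ^ (-β) := by rw [← add_mul, hab]; linarith
  · have hdz : d z = 0 := by rcases hz with rfl | rfl <;> assumption
    have hz01 : z ∈ Icc (0 : ℝ) 1 := by rcases hz with rfl | rfl <;> simp
    have hi' := htaylor hz01 (mid_mem_Icc i.2) hiz
    have hx' := htaylor hz01 hx hxz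
    rw [hdz, zero_mul, sub_zero, abs_le] at hi' hx'
    rw [← add_mul, hab, one_mul, abs_le]
    constructor <;> linarith

theorem abs_sub_sub_derivWithin_mul_le (hβ : 1 < β) (hL : 0 ≤ L)
    (hf : DifferentiableOn ℝ f (Icc 0 1))
    (h : ∀ x ∈ Icc (0 : ℝ) 1, ∀ y ∈ Icc (0 : ℝ) 1,
      |derivWithin f (Icc 0 1) x - derivWithin f (Icc 0 1) y| ≤ L * |x - y| ^ (β - 1))
    {x y : ℝ} (hx : x ∈ Icc (0 : ℝ) 1) (hy : y ∈ Icc (0 : ℝ) 1) :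
    |f y - f x - derivWithin f (Icc 0 1) x * (y - x)| ≤ L * |y - x| ^ β := by
  set d := derivWithin f (Icc 0 1)
  have hsub : uIcc x y ⊆ Icc 0 1 := uIcc_subset_Icc hx hy
  have hderiv (z) (hz : z ∈ uIcc x y) :
      HasDerivWithinAt (fun z => f z - d x * z) (d z - d x) (uIcc x y) z := by
    have := ((hf z (hsub hz)).hasDerivWithinAt.mono hsub).sub
      ((hasDerivWithinAt_id z (uIcc x y)).const_mul (d x))
    rwa [mul_one] at this
  have hbound (z) (hz : z ∈ uIcc x y) : ‖d z - d x‖ ≤ L * |y - x| ^ (β - 1) := by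
    have hzy : |z - x| ≤ |y - x| := abs_sub_left_of_mem_uIcc hz
    refine (h z (hsub hz) x hx).trans ?_
    gcongr
  calc |f y - f x - d x * (y - x)| = ‖f y - d x * y - (f x - d x * x)‖ := by
        rw [Real.norm_eq_abs]; ring_nf
    _ ≤ L * |y - x| ^ (β - 1) * ‖y - x‖ :=
        (convex_uIcc x y).norm_image_sub_le_of_norm_hasDerivWithin_le hderiv hbound
          left_mem_uIcc right_mem_uIcc
    _ = L * |y - x| ^ β := by
        rcases eq_or_ne y x with rfl | hne
        · rw [sub_self, abs_zero, norm_zero, mul_zero, Real.zero_rpow (by linarith), mul_zero]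
        · have hpos : |y - x| ≠ 0 := abs_ne_zero.2 (sub_ne_zero.2 hne)
          rw [Real.norm_eq_abs, mul_assoc, Real.rpow_sub_one hpos, div_mul_cancel₀ _ hpos]

theorem eq_zero_of_isLittleO_rpow {g r : ℝ → ℝ} {l : Filter ℝ} [l.NeBot] {c p y : ℝ}
    (hp : 0 < p) (hr : Tendsto r l (𝓝 0))
    (hg : (fun x => g x - c * r x ^ p) =o[l] fun x => r x ^ p) (hy : Tendsto g l (𝓝 y)) :
    y = 0 := by
  have hpow : Tendsto (fun x => r x ^ p) l (𝓝 0) := by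
    simpa only [Real.zero_rpow hp.ne'] using hr.rpow_const (p := p) (.inr hp.le)
  have hg0 := (hg.isBigO.trans_tendsto hpow).add (hpow.const_mul c)
  simp only [sub_add_cancel, mul_zero, add_zero] at hg0
  exact tendsto_nhds_unique hy hg0

theorem continuousOn_of_abs_sub_le {γ : ℝ} {s : Set ℝ} (hγ : 0 < γ)
    (h : ∀ x ∈ s, ∀ y ∈ s, |f x - f y| ≤ L * |x - y| ^ γ) : ContinuousOn f s := by
  intro z hz
  have hcont : ContinuousAt (fun x => L * |x - z| ^ γ) z :=
    continuousAt_const.mul (ContinuousAt.rpow_const (by fun_prop) (.inr hγ.le))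
  have hlim := hcont.tendsto.mono_left (nhdsWithin_le_nhds (s := s))
  rw [sub_self, abs_zero, Real.zero_rpow hγ.ne', mul_zero] at hlim
  rw [ContinuousWithinAt, tendsto_iff_norm_sub_tendsto_zero]
  exact squeeze_zero' (.of_forall fun _ => norm_nonneg _)
    (eventually_mem_nhdsWithin.mono fun x hx => h x hx z hz) hlim

theorem BC1.derivWithin_zero (hβ : 1 < β) (h : BC1 β f)
    (hf : ContinuousOn (derivWithin f (Icc 0 1)) (Icc 0 1)) : derivWithin f (Icc 0 1) 0 = 0 := by
  obtain ⟨a₀, p, hp, h⟩ := h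
  exact eq_zero_of_isLittleO_rpow (r := id) (by linarith) (tendsto_id.mono_left nhdsWithin_le_nhds)
    h ((hf 0 (by simp)).mono_left (nhdsWithin_le_of_mem (Icc_mem_nhdsGT zero_lt_one)))

theorem BC2.derivWithin_one (hβ : 1 < β) (h : BC2 β f)
    (hf : ContinuousOn (derivWithin f (Icc 0 1)) (Icc 0 1)) : derivWithin f (Icc 0 1) 1 = 0 := by
  obtain ⟨b₀, q, hq, h⟩ := h
  have hlim : Tendsto (fun x : ℝ => 1 - x) (𝓝[<] 1) (𝓝 0) := by
    have : Continuous fun x : ℝ => 1 - x := by fun_prop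
    simpa only [sub_self] using (this.tendsto 1).mono_left nhdsWithin_le_nhds
  exact eq_zero_of_isLittleO_rpow (by linarith) hlim h
    ((hf 1 (by simp)).mono_left (nhdsWithin_le_of_mem (Icc_mem_nhdsLT zero_lt_one)))

theorem HolderSmooth.exists_slope (hβ : 0 < β) (hβ2 : β ≤ 2) (hf : HolderSmooth β f)
    (hBC : 1 < β → BC1 β f ∧ BC2 β f) :
    ∃ L : ℝ, 0 ≤ L ∧ ∃ d : ℝ → ℝ, d 0 = 0 ∧ d 1 = 0 ∧
      ∀ x ∈ Icc (0 : ℝ) 1, ∀ y ∈ Icc (0 : ℝ) 1,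
        |f y - f x - d x * (y - x)| ≤ L * |y - x| ^ β := by
  obtain ⟨hC, L, hL, hH⟩ := hf
  refine ⟨L, hL.le, ?_⟩
  rcases le_or_gt β 1 with h1 | h1
  · have hceil : ⌈β⌉₊ = 1 := by
      rw [Nat.ceil_eq_iff one_ne_zero]; simpa using ⟨hβ, h1⟩
    simp only [hceil, tsub_self, iteratedDerivWithin_zero, Nat.cast_zero, sub_zero] at hH
    refine ⟨fun _ => 0, rfl, rfl, fun x hx y hy => ?_⟩
    simpa only [zero_mul, sub_zero] using hH y hy x hx
  · have hceil : ⌈β⌉₊ = 2 := by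
      rw [Nat.ceil_eq_iff two_ne_zero]; push_cast; constructor <;> linarith
    simp only [hceil, Nat.reduceSub, Nat.cast_one, iteratedDerivWithin_one] at hH hC
    have hcont := continuousOn_of_abs_sub_le (sub_pos.2 h1) hH
    obtain ⟨hBC1, hBC2⟩ := hBC h1
    exact ⟨_, hBC1.derivWithin_zero h1 hcont, hBC2.derivWithin_one h1 hcont, fun x hx y hy =>
      abs_sub_sub_derivWithin_mul_le h1 hL.le (hC.differentiableOn one_ne_zero) hH hx hy⟩

theorem exists_polygon_approx (hβ : 0 < β) (hβ2 : β ≤ 2) (hf : HolderSmooth β f)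
    (hBC : 1 < β → BC1 β f ∧ BC2 β f) :
    ∃ A : ℝ, 1 ≤ A ∧ ∀ (k : ℕ+), ∀ x ∈ Icc (0 : ℝ) 1,
      |polygon k (fun j => f (mid k j) / k) x - f x| ≤ A * (k : ℝ) ^ (-β) := by
  obtain ⟨L, hL, d, h0, h1, hd⟩ := hf.exists_slope hβ hβ2 hBC
  refine ⟨max 1 (2 * L), le_max_left _ _, fun k x hx => ?_⟩
  refine (abs_polygon_sub_le hβ.le hL hd h0 h1 k hx).trans ?_
  gcongr
  exact le_max_right _ _

end Approximation

/-! ### Chi-square neighbourhoods -/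

section ChiSq

variable {f : ℝ → ℝ}

/-- Integrated over `x`, this turns `∫ q² / p` into `1` plus a multiple of `∫ q⁻¹`, since
`q² / p + p = 2 q + (p - q)² / p`. -/
theorem mul_inv_div_add_le {q p e S : ℝ} (hq : 0 ≤ q) (he : 0 < e) (hS : 0 < S) (hp : q / S ≤ p)
    (hpq : |p - q| ≤ e) :
    ENNReal.ofReal q * (ENNReal.ofReal p / ENNReal.ofReal q)⁻¹ + ENNReal.ofReal p
      ≤ 2 * ENNReal.ofReal q + ENNReal.ofReal (e ^ 2 * S) * (ENNReal.ofReal q)⁻¹ := by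
  rcases hq.eq_or_lt with rfl | hq
  · have hne : ENNReal.ofReal (e ^ 2 * S) ≠ 0 := by
      rw [Ne, ENNReal.ofReal_eq_zero, not_le]
      positivity
    simp [ENNReal.mul_top hne]
  have hp0 : 0 < p := (div_pos hq hS).trans_le hp
  rw [← ENNReal.ofReal_div_of_pos hq, ← ENNReal.ofReal_inv_of_pos (by positivity),
    ← ENNReal.ofReal_inv_of_pos hq, ← ENNReal.ofReal_mul hq.le,
    ← ENNReal.ofReal_mul (by positivity), ← ENNReal.ofReal_add (by positivity) hp0.le,
    ← ENNReal.ofReal_ofNat 2, ← ENNReal.ofReal_mul (by positivity),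
    ← ENNReal.ofReal_add (by positivity) (by positivity)]
  apply ENNReal.ofReal_le_ofReal
  have hsq : (p - q) ^ 2 ≤ e ^ 2 := sq_le_sq' (abs_le.1 hpq).1 (abs_le.1 hpq).2
  have hinv : p⁻¹ ≤ S * q⁻¹ := by
    rw [← div_eq_mul_inv, ← inv_div]
    exact inv_anti₀ (by positivity) hp
  calc q * (p / q)⁻¹ + p = 2 * q + (p - q) ^ 2 * p⁻¹ := by field_simp; ring
    _ ≤ 2 * q + e ^ 2 * (S * q⁻¹) := by gcongr
    _ = 2 * q + e ^ 2 * S * q⁻¹ := by ring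

theorem mem_chiSqBall_of_abs_sub_le (hf : Measurable f) (hd : IsDensity f) {θ : Param}
    (hθ : ∫⁻ x, ENNReal.ofReal (θ.density x) ∂lam = 1) {e S : ℝ} (he : 0 < e) (hS : 0 < S)
    (hdiv : ∀ x ∈ Icc (0 : ℝ) 1, f x / S ≤ θ.density x)
    (habs : ∀ x ∈ Icc (0 : ℝ) 1, |θ.density x - f x| ≤ e) :
    θ ∈ chiSqBall f
      (1 + ENNReal.ofReal (e ^ 2 * S) * ∫⁻ x, (ENNReal.ofReal (f x))⁻¹ ∂lam) := by
  have hm : Measurable θ.density := measurable_density.of_uncurry_left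
  have h : ∫⁻ x, (ENNReal.ofReal (f x) * (densityRatio f θ x)⁻¹ + ENNReal.ofReal (θ.density x)) ∂lam
      ≤ ∫⁻ x, (2 * ENNReal.ofReal (f x)
        + ENNReal.ofReal (e ^ 2 * S) * (ENNReal.ofReal (f x))⁻¹) ∂lam := by
    refine lintegral_mono_ae (ae_lam_mem.mono fun x hx => ?_)
    exact mul_inv_div_add_le (hd.1 x hx) he hS (hdiv x hx) (habs x hx)
  rw [lintegral_add_right _ (by fun_prop), hθ, lintegral_add_left (by fun_prop),
    lintegral_const_mul _ (by fun_prop), hd.2,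
    lintegral_const_mul (f := fun x => (ENNReal.ofReal (f x))⁻¹) _ (by fun_prop), mul_one,
    ← one_add_one_eq_two, add_assoc, add_comm _ (1 : ℝ≥0∞)] at h
  have hratio : Measurable fun x => (densityRatio f θ x)⁻¹ :=
    (measurable_densityRatio hf).of_uncurry_left.inv
  rw [chiSqBall, mem_ofPred_eq, lintegral_obsLaw hf hratio]
  exact (ENNReal.add_le_add_iff_left ENNReal.one_ne_top).1 h

theorem chiSqBall_subset (f : ℝ → ℝ) {s t : ℝ≥0∞} (h : s ≤ t) : chiSqBall f s ⊆ chiSqBall f t :=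
  fun _ hθ => le_trans hθ h

variable {k : ℕ+} {v g : Fin k → ℝ} {F e : ℝ}

theorem polygon_mem_Icc_of_mem_box {x y ε δ : ℝ} (hx : x ∈ Icc (0 : ℝ) 1)
    (hv : |polygon k v x - y| ≤ ε)
    (hg : ∀ j, g j ∈ Icc (v j + ε / k) (v j + ε / k + δ / k)) :
    polygon k g x ∈ Icc y (y + (2 * ε + δ)) := by
  have hk := natCast_pnat_pos k
  have hshift (t : ℝ) : polygon k (fun j => v j + t / k) x = polygon k v x + t := by
    rw [polygon_add v (fun _ => t / k) hx, polygon_const _ hx, mul_div_cancel₀ _ hk.ne']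
  have hlow := polygon_mono (fun j => (hg j).1) hx
  have hupp := polygon_mono (v := fun j => v j + (ε + δ) / k)
    (fun j => (hg j).2.trans_eq (by ring)) hx
  rw [hshift] at hlow hupp
  constructor <;> linarith [abs_le.1 hv]

theorem sum_mem_Icc_of_polygon_mem_Icc (hd : IsDensity f) (he : 0 ≤ e) (hg : ∀ j, 0 ≤ g j)
    (hfg : ∀ x ∈ Icc (0 : ℝ) 1, polygon k g x ∈ Icc (f x) (f x + e)) :
    ∑ j, g j ∈ Icc 1 (1 + e) := by
  constructor
  · rw [← ENNReal.one_le_ofReal, ← lintegral_polygon hg, ← hd.2]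
    exact lintegral_mono_ae (ae_lam_mem.mono fun x hx => ENNReal.ofReal_le_ofReal (hfg x hx).1)
  · rw [← ENNReal.ofReal_le_ofReal_iff (by positivity), ← lintegral_polygon hg]
    calc ∫⁻ x, ENNReal.ofReal (polygon k g x) ∂lam
        ≤ ∫⁻ x, (ENNReal.ofReal (f x) + ENNReal.ofReal e) ∂lam :=
          lintegral_mono_ae (ae_lam_mem.mono fun x hx =>
            (ENNReal.ofReal_le_ofReal (hfg x hx).2).trans ENNReal.ofReal_add_le)
      _ = ENNReal.ofReal (1 + e) := by
          rw [lintegral_add_right _ measurable_const, hd.2, lintegral_const, measure_univ, mul_one,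
            ENNReal.ofReal_add zero_le_one he, ENNReal.ofReal_one]

theorem abs_div_sub_le {q y S : ℝ} (hq : q ∈ Icc y (y + e)) (hS : S ∈ Icc 1 (1 + e))
    (hy : y ∈ Icc 0 F) : |q / S - y| ≤ e * (1 + F) := by
  have hS0 : 0 < S := one_pos.trans_le hS.1
  have he : 0 ≤ e := by linarith [hS.1.trans hS.2]
  have hyF : y * (S - 1) ≤ F * e :=
    mul_le_mul hy.2 (by linarith [hS.2]) (by linarith [hS.1]) (hy.1.trans hy.2)
  rw [abs_sub_le_iff]
  constructor
  · have hle : q / S ≤ q := div_le_self (hy.1.trans hq.1) hS.1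
    nlinarith [hq.2, mul_nonneg he (hy.1.trans hy.2)]
  · have hge : y / S ≤ q / S := by gcongr; exact hq.1
    have hdiff : y - y / S = y * (S - 1) / S := by field_simp
    have hself : y * (S - 1) / S ≤ y * (S - 1) :=
      div_le_self (mul_nonneg hy.1 (by linarith [hS.1])) hS.1
    linarith

theorem normalize_mem_chiSqBall (hf : Measurable f) (hd : IsDensity f)
    (hF : ∀ x ∈ Icc (0 : ℝ) 1, f x ≤ F) (he : 0 < e) (hg : ∀ j, 0 ≤ g j)
    (hfg : ∀ x ∈ Icc (0 : ℝ) 1, polygon k g x ∈ Icc (f x) (f x + e)) :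
    (⟨k, fun j => g j / ∑ i, g i⟩ : Param) ∈ chiSqBall f
      (1 + ENNReal.ofReal ((e * (1 + F)) ^ 2 * (1 + e)) *
        ∫⁻ x, (ENNReal.ofReal (f x))⁻¹ ∂lam) := by
  have hF0 : 0 ≤ F := (hd.1 0 (by simp)).trans (hF 0 (by simp))
  have hS := sum_mem_Icc_of_polygon_mem_Icc hd he.le hg hfg
  have hS0 : 0 < ∑ j, g j := one_pos.trans_le hS.1
  refine mem_chiSqBall_of_abs_sub_le hf hd ?_ (by positivity) (by positivity)
    (fun x hx => ?_) fun x hx => ?_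
  · change ∫⁻ x, ENNReal.ofReal (polygon k (fun j => g j / ∑ i, g i) x) ∂lam = 1
    rw [lintegral_polygon fun j => div_nonneg (hg j) hS0.le, ← Finset.sum_div, div_self hS0.ne',
      ENNReal.ofReal_one]
  · rw [Param.density, polygon_div g _ hx]
    exact div_le_div₀ (polygon_nonneg hg hx) (hfg x hx).1 hS0 hS.2
  · rw [Param.density, polygon_div g _ hx]
    exact abs_div_sub_le (hfg x hx) hS ⟨hd.1 x hx, hF x hx⟩

end ChiSq

/-! ### Dirichlet distributions -/

theorem exists_Gamma_le (C : ℝ) : ∃ G, 0 < G ∧ ∀ a ∈ Ioc 0 C, Real.Gamma (a + 1) ≤ G := by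
  have hcont : ContinuousOn Real.Gamma (Icc 1 (C + 1)) := fun x hx => by
    refine (Real.differentiableAt_Gamma fun m => ?_).continuousAt.continuousWithinAt
    linarith [hx.1, (Nat.cast_nonneg m : (0 : ℝ) ≤ m)]
  obtain ⟨G, hG⟩ := isCompact_Icc.bddAbove_image hcont
  refine ⟨max G 1, by positivity, fun a ha => le_max_of_le_left (hG (mem_image_of_mem _ ?_))⟩
  exact ⟨by linarith [ha.1], by linarith [ha.2]⟩

theorem ofReal_le_gammaPDF {a x η C G W : ℝ} (ha : a ∈ Ioc 0 C) (hG : Real.Gamma (a + 1) ≤ G)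
    (hη : η ∈ Ioc 0 1) (hηx : η ≤ x) (hxW : x ≤ W) :
    ENNReal.ofReal (Real.exp (-W) / (G * W) * a * η ^ C) ≤ gammaPDF a 1 x := by
  have ha0 := ha.1
  have hη0 := hη.1
  have hx0 : 0 < x := hη0.trans_le hηx
  have hG0 : 0 < G := (Real.Gamma_pos_of_pos (by positivity)).trans_le hG
  have hW0 : 0 < W := hx0.trans_le hxW
  have hΓ : a / G ≤ 1 / Real.Gamma a := by
    rw [div_le_div_iff₀ hG0 (Real.Gamma_pos_of_pos ha0), one_mul, ← Real.Gamma_add_one ha0.ne']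
    exact hG
  have hpow : η ^ C / W ≤ x ^ (a - 1) := by
    have : η ^ C ≤ x ^ a := (Real.rpow_le_rpow_of_exponent_ge hη0 hη.2 ha.2).trans
      (Real.rpow_le_rpow hη0.le hηx ha0.le)
    rw [Real.rpow_sub_one hx0.ne']
    gcongr
  rw [gammaPDF_of_nonneg hx0.le, Real.one_rpow, one_mul]
  apply ENNReal.ofReal_le_ofReal
  calc Real.exp (-W) / (G * W) * a * η ^ C = a / G * (η ^ C / W) * Real.exp (-W) := by field_simp
    _ ≤ 1 / Real.Gamma a * x ^ (a - 1) * Real.exp (-x) := by gcongr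

theorem exists_gammaMeasure_Icc_ge (C : ℝ) {V : ℝ} (hV : 0 ≤ V) :
    ∃ κ : ℝ, 0 < κ ∧ ∀ a ∈ Ioc 0 C, ∀ η ∈ Ioc (0 : ℝ) 1, ∀ v, η ≤ v → v ≤ V →
      ENNReal.ofReal (κ * a * η ^ (C + 1)) ≤ gammaMeasure a 1 (Icc v (v + η)) := by
  obtain ⟨G, hG0, hG⟩ := exists_Gamma_le C
  refine ⟨Real.exp (-(V + 1)) / (G * (V + 1)), by positivity, fun a ha η hη v hηv hvV => ?_⟩
  have ha0 := ha.1
  have hη0 := hη.1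
  calc ENNReal.ofReal (Real.exp (-(V + 1)) / (G * (V + 1)) * a * η ^ (C + 1))
      = ∫⁻ _ in Icc v (v + η),
          ENNReal.ofReal (Real.exp (-(V + 1)) / (G * (V + 1)) * a * η ^ C) := by
        rw [setLIntegral_const, Real.volume_Icc, add_sub_cancel_left,
          ← ENNReal.ofReal_mul (by positivity), Real.rpow_add_one hη0.ne', mul_assoc _ (η ^ C)]
    _ ≤ ∫⁻ x in Icc v (v + η), gammaPDF a 1 x :=
        setLIntegral_mono' measurableSet_Icc fun x hx =>
          ofReal_le_gammaPDF ha (hG a ha) hη (hηv.trans hx.1) (by linarith [hx.2, hη.2])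
    _ = gammaMeasure a 1 (Icc v (v + η)) := by
        rw [gammaMeasure, withDensity_apply _ measurableSet_Icc]

theorem ae_gammaMeasure_pos (a r : ℝ) : ∀ᵐ x ∂(gammaMeasure a r), 0 < x := by
  have hneg : gammaMeasure a r (Iio 0) = 0 := by
    rw [gammaMeasure, withDensity_apply _ measurableSet_Iio]
    exact lintegral_gammaPDF_of_nonpos le_rfl
  have hzero : gammaMeasure a r {0} = 0 := withDensity_absolutelyContinuous volume _ (by simp)
  rw [ae_iff]
  simp only [not_lt]
  exact measure_mono_null (fun x (hx : x ≤ 0) => hx.lt_or_eq) (measure_union_null hneg hzero)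

section Dirichlet

variable {k : ℕ} {a : Fin k → ℝ}

theorem measurable_normalize (k : ℕ) :
    Measurable fun (g : Fin k → ℝ) (j : Fin k) => g j / ∑ i, g i := by
  fun_prop

theorem isProbabilityMeasure_dirichlet (ha : ∀ j, 0 < a j) :
    IsProbabilityMeasure (dirichlet a) := by
  have (j : Fin k) : IsProbabilityMeasure (gammaMeasure (a j) 1) :=
    isProbabilityMeasure_gammaMeasure (ha j) one_pos
  exact Measure.isProbabilityMeasure_map (measurable_normalize k).aemeasurable

theorem prod_gammaMeasure_le_dirichlet (ha : ∀ j, 0 < a j) {s : Fin k → Set ℝ}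
    {D : Set (Fin k → ℝ)} (h : ∀ g : Fin k → ℝ, (∀ j, g j ∈ s j) → (fun j => g j / ∑ i, g i) ∈ D) :
    ∏ j, gammaMeasure (a j) 1 (s j) ≤ dirichlet a D := by
  have (j : Fin k) : IsProbabilityMeasure (gammaMeasure (a j) 1) :=
    isProbabilityMeasure_gammaMeasure (ha j) one_pos
  rw [← Measure.pi_pi]
  exact (measure_mono fun g (hg : g ∈ univ.pi s) => h g fun j => hg j (mem_univ j)).trans
    (Measure.le_map_apply (measurable_normalize k).aemeasurable D)

theorem ae_dirichlet_mem_stdSimplex (hk : 0 < k) (ha : ∀ j, 0 < a j) :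
    ∀ᵐ w ∂(dirichlet a), w ∈ stdSimplex ℝ (Fin k) := by
  have (j : Fin k) : IsProbabilityMeasure (gammaMeasure (a j) 1) :=
    isProbabilityMeasure_gammaMeasure (ha j) one_pos
  have : Nonempty (Fin k) := ⟨⟨0, hk⟩⟩
  refine (ae_map_iff (measurable_normalize k).aemeasurable
    (isClosed_stdSimplex ℝ (Fin k)).measurableSet).2 ?_
  have hpos : ∀ᵐ g ∂(Measure.pi fun j => gammaMeasure (a j) 1), ∀ j, 0 < g j :=
    ae_pi_forall fun j => ae_gammaMeasure_pos (a j) 1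
  filter_upwards [hpos] with g hg
  have hsum : 0 < ∑ i, g i := Finset.sum_pos (fun i _ => hg i) Finset.univ_nonempty
  exact ⟨fun j => (div_pos (hg j) hsum).le, by rw [← Finset.sum_div, div_self hsum.ne']⟩

end Dirichlet

theorem exists_exp_neg_le_mul_rpow_pow {b : ℝ} (hb : 0 < b) (γ : ℝ) : ∃ D, 0 < D ∧ ∀ k : ℕ+,
    Real.exp (-D * (k * (1 + Real.log k))) ≤ (b * (k : ℝ) ^ (-γ)) ^ (k : ℕ) := by
  refine ⟨|Real.log b| + |γ| + 1, by positivity, fun k => ?_⟩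
  have hk := natCast_pnat_pos k
  have hlog : 0 ≤ Real.log k := Real.log_natCast_nonneg k
  have hpos : 0 < b * (k : ℝ) ^ (-γ) := by positivity
  rw [← Real.exp_log hpos, ← Real.exp_nat_mul, Real.log_mul hb.ne' (by positivity),
    Real.log_rpow hk, ← mul_assoc, mul_comm (-_) (k : ℝ), mul_assoc]
  gcongr
  nlinarith [neg_abs_le (Real.log b), abs_nonneg (Real.log b), abs_nonneg γ,
    mul_nonneg (abs_nonneg (Real.log b)) hlog, mul_le_mul_of_nonneg_right (le_abs_self γ) hlog]

section PriorMass

variable {f : ℝ → ℝ} {F A : ℝ}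

theorem normalize_mem_chiSqBall_of_mem_box (hf : Measurable f) (hd : IsDensity f)
    (hF : ∀ x ∈ Icc (0 : ℝ) 1, f x ≤ F) (hA : 1 ≤ A) {J r : ℝ} (hJ0 : 0 ≤ J)
    (hJ : ∫⁻ x, (ENNReal.ofReal (f x))⁻¹ ∂lam ≤ ENNReal.ofReal J) (hr : 0 < r) (hr1 : r ≤ 1)
    {k : ℕ+}
    (happ : ∀ x ∈ Icc (0 : ℝ) 1, |polygon k (fun j => f (mid k j) / k) x - f x| ≤ A * r)
    {g : Fin k → ℝ} (hg : ∀ j : Fin k,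
      g j ∈ Icc (f (mid k j) / k + A * r / k) (f (mid k j) / k + A * r / k + r / k)) :
    (⟨k, fun j => g j / ∑ i, g i⟩ : Param) ∈ chiSqBall f
      (1 + ENNReal.ofReal (((2 * A + 1) * (1 + F)) ^ 2 * (2 * A + 2) * J * r ^ 2)) := by
  have hg0 (j : Fin k) : 0 ≤ g j := by
    have := hd.1 _ (mid_mem_Icc j.2)
    exact le_trans (by positivity) (hg j).1
  refine chiSqBall_subset f ?_ (normalize_mem_chiSqBall hf hd hF (e := 2 * (A * r) + r)
    (by positivity) hg0 fun x hx => polygon_mem_Icc_of_mem_box hx (happ x hx) hg)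
  gcongr
  refine (mul_le_mul_right hJ _).trans ?_
  rw [← ENNReal.ofReal_mul (by positivity)]
  apply ENNReal.ofReal_le_ofReal
  calc ((2 * (A * r) + r) * (1 + F)) ^ 2 * (1 + (2 * (A * r) + r)) * J
      = ((2 * A + 1) * (1 + F)) ^ 2 * (1 + (2 * A + 1) * r) * J * r ^ 2 := by ring
    _ ≤ ((2 * A + 1) * (1 + F)) ^ 2 * (2 * A + 2) * J * r ^ 2 := by
        have : (2 * A + 1) * r ≤ 2 * A + 1 := mul_le_of_le_one_right (by linarith) hr1
        gcongr _ * ?_ * _ * _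
        linarith

theorem exists_dirichlet_chiSqBall_ge (hf : Measurable f) (hd : IsDensity f)
    (hF : ∀ x ∈ Icc (0 : ℝ) 1, f x ≤ F) (hA : 1 ≤ A) {β c : ℝ} (hβ : 0 < β) (hc : 0 < c) (C : ℝ)
    (happ : ∀ (k : ℕ+), ∀ x ∈ Icc (0 : ℝ) 1,
      |polygon k (fun j => f (mid k j) / k) x - f x| ≤ A * (k : ℝ) ^ (-β))
    (hJ : ∫⁻ x, (ENNReal.ofReal (f x))⁻¹ ∂lam < ∞) :
    ∃ C₂ D : ℝ, 0 < C₂ ∧ 0 < D ∧ ∀ (k : ℕ+) (a : Fin k → ℝ), (∀ j, c / k ≤ a j ∧ a j ≤ C) →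
      ENNReal.ofReal (Real.exp (-D * (k * (1 + Real.log k)))) ≤ dirichlet a
        {w | (⟨k, w⟩ : Param) ∈ chiSqBall f (1 + ENNReal.ofReal (C₂ * ((k : ℝ) ^ (-β)) ^ 2))} := by
  have hF0 : 0 ≤ F := (hd.1 0 (by simp)).trans (hF 0 (by simp))
  obtain ⟨κ, hκ, hgamma⟩ := exists_gammaMeasure_Icc_ge C (V := F + A) (by positivity)
  obtain ⟨D, hD, hexp⟩ := exists_exp_neg_le_mul_rpow_pow (mul_pos hκ hc) (1 + (β + 1) * (C + 1))
  obtain ⟨J, hJ0, hJ⟩ : ∃ J, 0 < J ∧ ∫⁻ x, (ENNReal.ofReal (f x))⁻¹ ∂lam ≤ ENNReal.ofReal J :=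
    ⟨(∫⁻ x, (ENNReal.ofReal (f x))⁻¹ ∂lam).toReal + 1, by positivity,
      ENNReal.le_ofReal_iff_toReal_le hJ.ne (by positivity) |>.2 (by linarith)⟩
  refine ⟨((2 * A + 1) * (1 + F)) ^ 2 * (2 * A + 2) * J, D, by positivity, hD, fun k a ha => ?_⟩
  have hk := natCast_pnat_pos k
  have hk1 : (1 : ℝ) ≤ k := mod_cast k.pos
  set r := (k : ℝ) ^ (-β) with hr
  have hr0 : 0 < r := by positivity
  have hr1 : r ≤ 1 := Real.rpow_le_one_of_one_le_of_nonpos hk1 (by linarith)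
  have ha0 (j : Fin k) : 0 < a j := (div_pos hc hk).trans_le (ha j).1
  have hη : r / k ∈ Ioc 0 1 := ⟨by positivity, (div_le_self hr0.le hk1).trans hr1⟩
  have hbox (j : Fin k) : ENNReal.ofReal (κ * (c / k) * (r / k) ^ (C + 1)) ≤ gammaMeasure (a j) 1
      (Icc (f (mid k j) / k + A * r / k) (f (mid k j) / k + A * r / k + r / k)) := by
    have hf0 := hd.1 _ (mid_mem_Icc j.2)
    have hfF := hF _ (mid_mem_Icc j.2)
    refine le_trans ?_ (hgamma (a j) ⟨ha0 j, (ha j).2⟩ (r / k) hη _ ?_ ?_)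
    · gcongr
      exact (ha j).1
    · rw [← add_div]
      gcongr
      nlinarith
    · rw [← add_div]
      exact (div_le_self (by positivity) hk1).trans (by nlinarith)
  calc ENNReal.ofReal (Real.exp (-D * (k * (1 + Real.log k))))
      ≤ ENNReal.ofReal ((κ * c * (k : ℝ) ^ (-(1 + (β + 1) * (C + 1)))) ^ (k : ℕ)) :=
        ENNReal.ofReal_le_ofReal (hexp k)
    _ = ∏ _ : Fin k, ENNReal.ofReal (κ * (c / k) * (r / k) ^ (C + 1)) := by
        rw [Finset.prod_const, Finset.card_univ, Fintype.card_fin,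
          ← ENNReal.ofReal_pow (by positivity), hr, ← Real.rpow_sub_one hk.ne',
          ← Real.rpow_mul hk.le, neg_add, Real.rpow_add hk, Real.rpow_neg_one]
        ring_nf
    _ ≤ _ := Finset.prod_le_prod' fun j _ => hbox j
    _ ≤ _ := prod_gammaMeasure_le_dirichlet ha0 fun g hg =>
        normalize_mem_chiSqBall_of_mem_box hf hd hF hA hJ0.le hJ hr0 hr1 (happ k) hg

end PriorMass

/-! ### The polygonally smoothed prior -/

theorem polygonPrior_apply (ρ : PMF ℕ+) (α : Measure ℝ) {S : Set Param} (hS : MeasurableSet S) :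
    polygonPrior ρ α S = ∑' k : ℕ+, ρ k *
      dirichlet (fun j : Fin k => (α (bin k j)).toReal) {w | (⟨k, w⟩ : Param) ∈ S} := by
  rw [polygonPrior, Measure.sum_apply _ hS]
  refine tsum_congr fun k => ?_
  rw [Measure.smul_apply, Measure.map_apply (measurableEmbedding_sigmaMk k).measurable hS,
    smul_eq_mul]
  rfl

theorem measurableSet_bin (k j : ℕ) : MeasurableSet (bin k j) := by
  unfold bin
  measurability

theorem bin_subset_Icc {k j : ℕ} (hj : j < k) : bin k j ⊆ Icc 0 1 := by
  have hk : (0 : ℝ) < k := mod_cast j.zero_le.trans_lt hj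
  have hj1 : ((j : ℝ) + 1) / k ≤ 1 := by
    rw [div_le_one hk]
    exact_mod_cast hj
  unfold bin
  split_ifs with h
  · subst h
    rw [Nat.cast_zero, zero_add] at hj1
    exact Icc_subset_Icc le_rfl hj1
  · exact Ioc_subset_Icc_self.trans (Icc_subset_Icc (by positivity) hj1)

theorem lam_bin {k j : ℕ} (hj : j < k) : lam (bin k j) = ENNReal.ofReal (1 / k) := by
  rw [lam, Measure.restrict_apply (measurableSet_bin k j), inter_eq_left.2 (bin_subset_Icc hj)]
  unfold bin
  split_ifs with h
  · rw [Real.volume_Icc, sub_zero]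
  · rw [Real.volume_Ioc, ← sub_div, add_sub_cancel_left]

theorem exists_bin_bounds {a : ℝ → ℝ} (ha : ContinuousOn a (Icc 0 1))
    (ha' : ∀ x ∈ Icc (0 : ℝ) 1, 0 < a x) : ∃ c C : ℝ, 0 < c ∧ ∀ (k : ℕ+) (j : Fin k),
      c / k ≤ ((lam.withDensity fun x => ENNReal.ofReal (a x)) (bin k j)).toReal ∧
      ((lam.withDensity fun x => ENNReal.ofReal (a x)) (bin k j)).toReal ≤ C := by
  have hne : (Icc (0 : ℝ) 1).Nonempty := ⟨0, by simp⟩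
  obtain ⟨x₀, hx₀, hmin⟩ := isCompact_Icc.exists_isMinOn hne ha
  obtain ⟨x₁, hx₁, hmax⟩ := isCompact_Icc.exists_isMaxOn hne ha
  refine ⟨a x₀, a x₁, ha' _ hx₀, fun k j => ?_⟩
  have hk1 : (1 : ℝ) ≤ k := mod_cast k.pos
  have hm := measurableSet_bin k j
  have hconst {x : ℝ} (hx : x ∈ Icc (0 : ℝ) 1) :
      ENNReal.ofReal (a x / k) = ∫⁻ _ in bin k j, ENNReal.ofReal (a x) ∂lam := by
    rw [setLIntegral_const, lam_bin j.2, ← ENNReal.ofReal_mul (ha' _ hx).le, mul_one_div]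
  have hlow : ENNReal.ofReal (a x₀ / k) ≤ ∫⁻ x in bin k j, ENNReal.ofReal (a x) ∂lam :=
    (hconst hx₀).trans_le <| setLIntegral_mono' hm fun x hx =>
      ENNReal.ofReal_le_ofReal (hmin (bin_subset_Icc j.2 hx))
  have hupp : ∫⁻ x in bin k j, ENNReal.ofReal (a x) ∂lam ≤ ENNReal.ofReal (a x₁ / k) :=
    (setLIntegral_mono' hm fun x hx =>
      ENNReal.ofReal_le_ofReal (hmax (bin_subset_Icc j.2 hx))).trans_eq (hconst hx₁).symm
  have hpos := ha' _ hx₁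
  have hfin : ∫⁻ x in bin k j, ENNReal.ofReal (a x) ∂lam ≠ ∞ :=
    ne_top_of_le_ne_top ENNReal.ofReal_ne_top hupp
  rw [withDensity_apply _ hm, ← ENNReal.ofReal_le_iff_le_toReal hfin]
  exact ⟨hlow, (ENNReal.toReal_le_of_le_ofReal (by positivity) hupp).trans
    (div_le_self hpos.le hk1)⟩

section Prior

variable {ρ : PMF ℕ+} {α : Measure ℝ}

theorem mul_dirichlet_le_polygonPrior (k : ℕ+) {S : Set Param} (hS : MeasurableSet S) :
    ρ k * dirichlet (fun j : Fin k => (α (bin k j)).toReal) {w | (⟨k, w⟩ : Param) ∈ S}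
      ≤ polygonPrior ρ α S := by
  rw [polygonPrior_apply ρ α hS]
  exact ENNReal.le_tsum k

variable (hpos : ∀ (k : ℕ+) (j : Fin k), 0 < (α (bin k j)).toReal)
include hpos

theorem isProbabilityMeasure_polygonPrior : IsProbabilityMeasure (polygonPrior ρ α) := by
  constructor
  rw [polygonPrior_apply ρ α MeasurableSet.univ, ← ρ.tsum_coe]
  refine tsum_congr fun k => ?_
  have := isProbabilityMeasure_dirichlet (hpos k)
  simp

theorem ae_polygonPrior_mem_stdSimplex :
    ∀ᵐ θ ∂(polygonPrior ρ α), θ.2 ∈ stdSimplex ℝ (Fin θ.1) := by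
  have hm : MeasurableSet {θ : Param | θ.2 ∈ stdSimplex ℝ (Fin θ.1)} :=
    measurableSet_sigma_iff.2 fun k => (isClosed_stdSimplex ℝ (Fin k)).measurableSet
  refine ae_iff.2 ((polygonPrior_apply ρ α hm.compl).trans (ENNReal.tsum_eq_zero.2 ?_))
  exact fun k => mul_eq_zero_of_right _ (ae_iff.1 (ae_dirichlet_mem_stdSimplex k.pos (hpos k)))

end Prior

/-- Half of the exponent `β₂ k log k` goes into the bound that is uniform in `k > K`, the other half
into a summable factor. -/
theorem exp_neg_mul_log_le {β₂ K k : ℝ} (hβ₂ : 0 ≤ β₂) (hK : 1 ≤ K) (hK2 : 2 ≤ β₂ * Real.log K)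
    (hKk : K ≤ k) : Real.exp (-β₂ * k * Real.log k)
      ≤ Real.exp (-(β₂ / 2 * (K * Real.log K))) * Real.exp (-k) := by
  have hlogK : 0 ≤ Real.log K := Real.log_nonneg hK
  have hlog : Real.log K ≤ Real.log k := Real.log_le_log (by linarith) hKk
  have hk : 0 ≤ k := by linarith
  have hfst : β₂ * (K * Real.log K) ≤ β₂ * (k * Real.log k) := by gcongr
  have hsnd : 2 * k ≤ β₂ * (k * Real.log k) :=
    calc 2 * k ≤ β₂ * Real.log K * k := by gcongr
      _ = β₂ * (k * Real.log K) := by ring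
      _ ≤ β₂ * (k * Real.log k) := by gcongr
  rw [← Real.exp_add, Real.exp_le_exp]
  linarith

theorem polygonPrior_fst_gt_le {ρ : PMF ℕ+} {α : Measure ℝ} {B₂ β₂ : ℝ} (hB₂ : 0 ≤ B₂)
    (hβ₂ : 0 ≤ β₂) (hρ : ∀ k : ℕ+, (ρ k).toReal ≤ B₂ * Real.exp (-β₂ * k * Real.log k))
    (hpos : ∀ (k : ℕ+) (j : Fin k), 0 < (α (bin k j)).toReal) {K : ℝ} (hK : 1 ≤ K)
    (hK2 : 2 ≤ β₂ * Real.log K) : polygonPrior ρ α {θ | K < (θ.1 : ℝ)}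
      ≤ ENNReal.ofReal
        (B₂ * Real.exp (-(β₂ / 2 * (K * Real.log K))) * ∑' k : ℕ, Real.exp (-(k : ℝ))) := by
  have hm : MeasurableSet {θ : Param | K < (θ.1 : ℝ)} :=
    measurableSet_sigma_iff.2 fun k => MeasurableSet.const (K < k)
  have hterm (k : ℕ+) : ρ k * dirichlet (fun j : Fin k => (α (bin k j)).toReal)
      {w | (⟨k, w⟩ : Param) ∈ {θ : Param | K < (θ.1 : ℝ)}}
      ≤ ENNReal.ofReal (B₂ * Real.exp (-(β₂ / 2 * (K * Real.log K))) * Real.exp (-(k : ℝ))) := by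
    have := isProbabilityMeasure_dirichlet (hpos k)
    by_cases h : K < (k : ℝ)
    · calc _ ≤ ρ k * 1 := by gcongr; exact prob_le_one
        _ = ENNReal.ofReal (ρ k).toReal := by
            rw [mul_one, ENNReal.ofReal_toReal (ρ.apply_ne_top k)]
        _ ≤ _ := by
            rw [mul_assoc B₂]
            exact ENNReal.ofReal_le_ofReal ((hρ k).trans
              (mul_le_mul_of_nonneg_left (exp_neg_mul_log_le hβ₂ hK hK2 h.le) hB₂))
    · simp [h]
  rw [polygonPrior_apply ρ α hm]
  refine (ENNReal.tsum_le_tsum hterm).trans ?_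
  rw [← tsum_mul_left, ENNReal.ofReal_tsum_of_nonneg (fun k => by positivity)
    (Real.summable_exp_neg_nat.mul_left _)]
  exact ENNReal.tsum_comp_le_tsum_of_injective PNat.coe_injective
    (fun k : ℕ => ENNReal.ofReal (B₂ * Real.exp (-(β₂ / 2 * (K * Real.log K))) * Real.exp (-k)))

/-! ### Hellinger affinity and the `L¹`-distance -/

theorem distL1_eq_lintegral (f g : ℝ → ℝ) :
    distL1 f g = ∫⁻ x, ENNReal.ofReal |f x - g x| ∂lam := by
  simp only [distL1, eLpNorm_one_eq_lintegral_enorm, Real.enorm_eq_ofReal_abs]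

theorem distL1_triangle {f g : ℝ → ℝ} (hf : Measurable f) (hg : Measurable g) (h : ℝ → ℝ) :
    distL1 f h ≤ distL1 f g + distL1 g h := by
  simp only [distL1_eq_lintegral]
  rw [← lintegral_add_left (by fun_prop)]
  refine lintegral_mono fun x => ?_
  rw [← ENNReal.ofReal_add (abs_nonneg _) (abs_nonneg _)]
  exact ENNReal.ofReal_le_ofReal (abs_sub_le _ _ _)

theorem distL1_add_lintegral_of_le {f g : ℝ → ℝ} (hf : Measurable f) (hg : Measurable g)
    (hf0 : ∀ x ∈ Icc (0 : ℝ) 1, 0 ≤ f x) (hfg : ∀ x ∈ Icc (0 : ℝ) 1, f x ≤ g x) :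
    distL1 f g + ∫⁻ x, ENNReal.ofReal (f x) ∂lam = ∫⁻ x, ENNReal.ofReal (g x) ∂lam := by
  rw [distL1_eq_lintegral, ← lintegral_add_left (by fun_prop)]
  refine lintegral_congr_ae ?_
  filter_upwards [ae_lam_mem] with x hx
  rw [← ENNReal.ofReal_add (abs_nonneg _) (hf0 x hx), abs_sub_comm,
    abs_of_nonneg (sub_nonneg.2 (hfg x hx)), sub_add_cancel]

theorem mul_sqrt_add_abs_sub_le {u q c : ℝ} (hu : 0 ≤ u) (hq : 0 ≤ q) (hc : 0 < c) :
    c * √(u * q) + |u - q| ≤ (c / 2 + 1 / c) * (u + q) := by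
  obtain ⟨a, ha, rfl⟩ : ∃ a, 0 ≤ a ∧ a ^ 2 = u := ⟨√u, Real.sqrt_nonneg _, Real.sq_sqrt hu⟩
  obtain ⟨b, hb, rfl⟩ : ∃ b, 0 ≤ b ∧ b ^ 2 = q := ⟨√q, Real.sqrt_nonneg _, Real.sq_sqrt hq⟩
  rw [← mul_pow, Real.sqrt_sq (by positivity), sq_sub_sq, abs_mul, abs_of_nonneg (add_nonneg ha hb)]
  have young : (a + b) * |a - b| ≤ c / 2 * (a - b) ^ 2 + 1 / (2 * c) * (a + b) ^ 2 := by
    have hsq : c / 2 * (a - b) ^ 2 + 1 / (2 * c) * (a + b) ^ 2 - (a + b) * |a - b|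
        = (c * |a - b| - (a + b)) ^ 2 / (2 * c) := by
      rw [← sq_abs (a - b)]; field_simp; ring
    have : 0 ≤ (c * |a - b| - (a + b)) ^ 2 / (2 * c) := by positivity
    linarith
  have hadd : 1 / (2 * c) * (a + b) ^ 2 ≤ 1 / c * (a ^ 2 + b ^ 2) := by
    rw [one_div_mul_eq_div, one_div_mul_eq_div, div_le_div_iff₀ (by positivity) hc]
    nlinarith [mul_nonneg hc.le (sq_nonneg (a - b))]
  nlinarith

theorem mul_lintegral_sqrt_mul_add_distL1_le {u q : ℝ → ℝ} (hu : Measurable u) (hq : Measurable q)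
    (hu0 : ∀ x ∈ Icc (0 : ℝ) 1, 0 ≤ u x) (hq0 : ∀ x ∈ Icc (0 : ℝ) 1, 0 ≤ q x)
    {c : ℝ} (hc : 0 < c) :
    ENNReal.ofReal c * ∫⁻ x, ENNReal.ofReal √(u x * q x) ∂lam + distL1 u q
      ≤ ENNReal.ofReal (c / 2 + 1 / c)
        * (∫⁻ x, ENNReal.ofReal (u x) ∂lam + ∫⁻ x, ENNReal.ofReal (q x) ∂lam) := by
  rw [distL1_eq_lintegral, ← lintegral_const_mul _ (by fun_prop),
    ← lintegral_add_left (by fun_prop), ← lintegral_add_left (by fun_prop),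
    ← lintegral_const_mul _ (by fun_prop)]
  refine lintegral_mono_ae ?_
  filter_upwards [ae_lam_mem] with x hx
  rw [← ENNReal.ofReal_mul hc.le, ← ENNReal.ofReal_add (by positivity) (abs_nonneg _),
    ← ENNReal.ofReal_add (hu0 x hx) (hq0 x hx), ← ENNReal.ofReal_mul (by positivity)]
  exact ENNReal.ofReal_le_ofReal (mul_sqrt_add_abs_sub_le (hu0 x hx) (hq0 x hx) hc)

theorem lintegral_sqrt_mul_le {u q : ℝ → ℝ} (hu : Measurable u) (hq : Measurable q)
    (hu0 : ∀ x ∈ Icc (0 : ℝ) 1, 0 ≤ u x) (hqd : IsDensity q) {τ d : ℝ} (hτ : 0 ≤ τ) (hτ1 : τ ≤ 1)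
    (hu1 : ∫⁻ x, ENNReal.ofReal (u x) ∂lam ≤ ENNReal.ofReal (1 + τ)) (hd : 0 < d)
    (hdist : ENNReal.ofReal d ≤ distL1 u q) :
    ∫⁻ x, ENNReal.ofReal √(u x * q x) ∂lam ≤ ENNReal.ofReal ((2 + τ) / 2 - d ^ 2 / 12) := by
  -- up to a constant factor the choice of `c` that optimises the bound
  set c := 6 / d with hc
  have hc0 : 0 < c := by positivity
  set A := ∫⁻ x, ENNReal.ofReal √(u x * q x) ∂lam
  have h : ENNReal.ofReal c * A + ENNReal.ofReal d
      ≤ ENNReal.ofReal ((c / 2 + 1 / c) * (2 + τ)) :=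
    calc ENNReal.ofReal c * A + ENNReal.ofReal d
        ≤ ENNReal.ofReal (c / 2 + 1 / c) * (ENNReal.ofReal (1 + τ) + 1) := by
          refine (add_le_add_right hdist _).trans
            ((mul_lintegral_sqrt_mul_add_distL1_le hu hq hu0 hqd.1 hc0).trans ?_)
          rw [hqd.2]
          gcongr
      _ = _ := by
          rw [← ENNReal.ofReal_one, ← ENNReal.ofReal_add (by positivity) zero_le_one,
            ← ENNReal.ofReal_mul (by positivity)]
          ring_nf
  have hAt : A ≠ ∞ := by
    intro hA
    rw [hA, ENNReal.mul_top (by simpa using hc0), top_add] at h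
    exact absurd h (not_le.2 ENNReal.ofReal_lt_top)
  rw [← ENNReal.ofReal_toReal hAt] at h ⊢
  have hA0 : 0 ≤ A.toReal := ENNReal.toReal_nonneg
  rw [← ENNReal.ofReal_mul hc0.le, ← ENNReal.ofReal_add (by positivity) hd.le,
    ENNReal.ofReal_le_ofReal_iff (by positivity)] at h
  refine ENNReal.ofReal_le_ofReal ?_
  calc A.toReal ≤ ((c / 2 + 1 / c) * (2 + τ) - d) / c := by
        rw [le_div_iff₀ hc0]; linarith
    _ = (2 + τ) / 2 + d ^ 2 / 36 * (2 + τ) - d ^ 2 / 6 := by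
        rw [hc]; field_simp; ring
    _ ≤ (2 + τ) / 2 - d ^ 2 / 12 := by
        nlinarith [mul_nonneg (sq_nonneg d) (sub_nonneg.2 hτ1)]

/-! ### Covering the polygons by boxes -/

theorem lintegral_density_of_mem_stdSimplex {θ : Param} (hθ : θ.2 ∈ stdSimplex ℝ (Fin θ.1)) :
    ∫⁻ x, ENNReal.ofReal (θ.density x) ∂lam = 1 := by
  rw [Param.density, lintegral_polygon hθ.1, hθ.2, ENNReal.ofReal_one]

section Box

variable {N : ℕ} {i : Σ k : ℕ+, (Fin k → Fin (N + 1))} {τ : ℝ} {θ : Param}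

/-- The box with index `i = ⟨k, g⟩`: all parameters with `k` weights that form a probability vector
and round down to `g j / N`. For fixed `N` the boxes form a countable partition of the parameters
with weights in the simplex. -/
def box (N : ℕ) (i : Σ k : ℕ+, (Fin k → Fin (N + 1))) : Set Param :=
  Sigma.mk i.1 '' {w | w ∈ stdSimplex ℝ (Fin i.1) ∧ ∀ j, ⌊(N : ℝ) * w j⌋₊ = i.2 j}

/-- The polygon with weights `(g j + 1) / N`, which dominates all densities that belong to the box
`⟨k, g⟩`. -/
noncomputable def boxUpper (N : ℕ) (i : Σ k : ℕ+, (Fin k → Fin (N + 1))) : ℝ → ℝ :=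
  polygon i.1 fun j => ((i.2 j : ℕ) + 1) / (N : ℝ)

theorem measurableSet_box (N : ℕ) (i : Σ k : ℕ+, (Fin k → Fin (N + 1))) :
    MeasurableSet (box N i) := by
  have hfloor : MeasurableSet {w : Fin i.1 → ℝ | ∀ j, ⌊(N : ℝ) * w j⌋₊ = i.2 j} := by
    rw [ofPred_forall]
    exact MeasurableSet.iInter fun j =>
      measurableSet_eq_fun (Nat.measurable_floor.comp (by fun_prop)) measurable_const
  exact (measurableEmbedding_sigmaMk i.1).measurableSet_image.2
    ((isClosed_stdSimplex ℝ _).measurableSet.inter hfloor)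

theorem measurable_boxUpper (N : ℕ) (i : Σ k : ℕ+, (Fin k → Fin (N + 1))) :
    Measurable (boxUpper N i) :=
  (measurable_polygon i.1).of_uncurry_left

theorem exists_mem_box {k : ℕ+} {w : Fin k → ℝ} (hw : w ∈ stdSimplex ℝ (Fin k)) :
    ∃ g : Fin k → Fin (N + 1), (⟨k, w⟩ : Param) ∈ box N ⟨k, g⟩ := by
  have hle (j : Fin k) : ⌊(N : ℝ) * w j⌋₊ < N + 1 :=
    Nat.lt_succ_of_le (Nat.floor_le_of_le
      (mul_le_of_le_one_right (Nat.cast_nonneg N) (mem_Icc_of_mem_stdSimplex hw j).2))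
  exact ⟨fun j => ⟨⌊(N : ℝ) * w j⌋₊, hle j⟩, w, ⟨hw, fun j => rfl⟩, rfl⟩

theorem density_le_boxUpper (hN : 0 < N) (hθ : θ ∈ box N i) {x : ℝ} (hx : x ∈ Icc (0 : ℝ) 1) :
    θ.density x ≤ boxUpper N i x := by
  obtain ⟨w, ⟨-, hg⟩, rfl⟩ := hθ
  refine polygon_mono (fun j => ?_) hx
  rw [le_div_iff₀ (Nat.cast_pos.2 hN), ← hg j, mul_comm]
  exact (Nat.lt_floor_add_one _).le

theorem boxUpper_nonneg {x : ℝ} (hx : x ∈ Icc (0 : ℝ) 1) : 0 ≤ boxUpper N i x :=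
  polygon_nonneg (fun _ => by positivity) hx

theorem lintegral_boxUpper_le (hN : 0 < N) (hτ : (i.1 : ℝ) ≤ τ * N) (hθ : θ ∈ box N i) :
    ∫⁻ x, ENNReal.ofReal (boxUpper N i x) ∂lam ≤ ENNReal.ofReal (1 + τ) := by
  obtain ⟨w, ⟨hw, hg⟩, rfl⟩ := hθ
  have hN' : (0 : ℝ) < N := by exact_mod_cast hN
  rw [boxUpper, lintegral_polygon fun _ => by positivity]
  refine ENNReal.ofReal_le_ofReal ?_
  calc ∑ j, ((i.2 j : ℕ) + 1) / (N : ℝ) ≤ ∑ j, (w j + 1 / N) := by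
        refine Finset.sum_le_sum fun j _ => ?_
        rw [add_div, ← hg j]
        gcongr
        rw [div_le_iff₀ hN', mul_comm]
        exact Nat.floor_le (mul_nonneg (hw.1 j) hN'.le)
    _ = 1 + i.1 / N := by
        rw [Finset.sum_add_distrib, hw.2, Finset.sum_const, Finset.card_univ, Fintype.card_fin,
          nsmul_eq_mul, mul_one_div]
    _ ≤ 1 + τ := by
        gcongr
        rwa [div_le_iff₀ hN']

theorem distL1_boxUpper_le (hN : 0 < N) (hτ0 : 0 ≤ τ) (hτ : (i.1 : ℝ) ≤ τ * N)
    (hθ : θ ∈ box N i) : distL1 θ.density (boxUpper N i) ≤ ENNReal.ofReal τ := by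
  have hθs : θ.2 ∈ stdSimplex ℝ (Fin θ.1) := by
    obtain ⟨w, ⟨hw, -⟩, rfl⟩ := hθ
    exact hw
  have hadd := distL1_add_lintegral_of_le measurable_density.of_uncurry_left
    (measurable_boxUpper N i) (fun x hx => polygon_nonneg hθs.1 hx)
    (fun x hx => density_le_boxUpper hN hθ hx)
  rw [lintegral_density_of_mem_stdSimplex hθs] at hadd
  rw [← ENNReal.add_le_add_iff_right ENNReal.one_ne_top, hadd]
  exact (lintegral_boxUpper_le hN hτ hθ).trans
    (by rw [add_comm, ENNReal.ofReal_add hτ0 zero_le_one, ENNReal.ofReal_one])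

theorem lintegral_sqrt_boxUpper_mul_le {f : ℝ → ℝ} (hf : Measurable f) (hd : IsDensity f)
    (hN : 0 < N) {d : ℝ} (hτ0 : 0 ≤ τ) (hτ1 : τ ≤ 1) (hτd : τ < d) (hτ : (i.1 : ℝ) ≤ τ * N)
    (hθ : θ ∈ box N i) (hdist : ENNReal.ofReal d < distL1 θ.density f) :
    ∫⁻ x, ENNReal.ofReal √(boxUpper N i x * f x) ∂lam
      ≤ ENNReal.ofReal ((2 + τ) / 2 - (d - τ) ^ 2 / 12) := by
  refine lintegral_sqrt_mul_le (measurable_boxUpper N i) hf (fun x hx => boxUpper_nonneg hx) hd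
    hτ0 hτ1 (lintegral_boxUpper_le hN hτ hθ) (sub_pos.2 hτd) ?_
  rw [ENNReal.ofReal_sub _ hτ0, tsub_le_iff_left]
  calc ENNReal.ofReal d ≤ distL1 θ.density (boxUpper N i) + distL1 (boxUpper N i) f :=
        hdist.le.trans (distL1_triangle measurable_density.of_uncurry_left
          (measurable_boxUpper N i) f)
    _ ≤ ENNReal.ofReal τ + distL1 (boxUpper N i) f := by
        gcongr
        exact distL1_boxUpper_le hN hτ0 hτ hθ

end Box

open Classical in
/-- The indices of the boxes with at most `K` bins that contain a parameter with property `p`. -/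
noncomputable def boxesMeeting (N : ℕ) (K : ℕ+) (p : Param → Prop) :
    Finset (Σ k : ℕ+, (Fin k → Fin (N + 1))) :=
  (Finset.Icc 1 K).sigma fun k => {g | ∃ θ ∈ box N ⟨k, g⟩, p θ}

theorem mem_boxesMeeting {N : ℕ} {K : ℕ+} {p : Param → Prop}
    {i : Σ k : ℕ+, (Fin k → Fin (N + 1))} :
    i ∈ boxesMeeting N K p ↔ i.1 ≤ K ∧ ∃ θ ∈ box N i, p θ := by
  simp [boxesMeeting]

theorem card_boxesMeeting_le (N : ℕ) (K : ℕ+) (p : Param → Prop) :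
    (boxesMeeting N K p).card ≤ K * (N + 1) ^ (K : ℕ) := by
  rw [boxesMeeting, Finset.card_sigma]
  calc _ ≤ ∑ k ∈ Finset.Icc (1 : ℕ+) K, (N + 1) ^ (K : ℕ) := by
        refine Finset.sum_le_sum fun k hk => (Finset.card_le_univ _).trans ?_
        rw [Fintype.card_fun, Fintype.card_fin, Fintype.card_fin]
        exact Nat.pow_le_pow_right (Nat.succ_pos N) (Finset.mem_Icc.1 hk).2
    _ = _ := by simp

theorem setOf_subset_union_box (N : ℕ) (K : ℕ+) (p : Param → Prop) :
    {θ | p θ} ⊆ ({θ | (K : ℝ) < (θ.1 : ℝ)} ∪ {θ | θ.2 ∉ stdSimplex ℝ (Fin θ.1)})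
      ∪ ⋃ i ∈ boxesMeeting N K p, box N i := by
  rintro ⟨k, w⟩ hθ
  by_cases hk : k ≤ K
  · by_cases hw : w ∈ stdSimplex ℝ (Fin k)
    · obtain ⟨g, hg⟩ := exists_mem_box (N := N) hw
      exact Or.inr (mem_iUnion₂.2 ⟨⟨k, g⟩, mem_boxesMeeting.2 ⟨hk, _, hg, hθ⟩, hg⟩)
    · exact Or.inl (Or.inr hw)
  · exact Or.inl (Or.inl (by exact_mod_cast not_le.1 hk))

theorem lintegral_postDist_distL1_gt_le {ρ : PMF ℕ+} {α : Measure ℝ}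
    (hpos : ∀ (k : ℕ+) (j : Fin k), 0 < (α (bin k j)).toReal)
    {f : ℝ → ℝ} (hf : Measurable f) (hd : IsDensity f) {N : ℕ} (hN : 0 < N) {K : ℕ+}
    {τ d : ℝ} (hτ : 0 ≤ τ) (hτ1 : τ ≤ 1) (hτd : τ < d) (hK : (K : ℝ) ≤ τ * N) {s c : ℝ≥0∞}
    (hB0 : polygonPrior ρ α (chiSqBall f s) ≠ 0) (hc0 : c ≠ 0) (hc : c ≠ ∞) (n : ℕ) :
    ∫⁻ X, postDist (polygonPrior ρ α) X {θ | ENNReal.ofReal d < distL1 θ.density f}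
        ∂(sampleLaw f n)
      ≤ c⁻¹ * s ^ n
        + c / polygonPrior ρ α (chiSqBall f s) * polygonPrior ρ α {θ | (K : ℝ) < (θ.1 : ℝ)}
        + K * (N + 1) ^ (K : ℕ) * ((c / polygonPrior ρ α (chiSqBall f s)) ^ (1 / 2 : ℝ)
          * ENNReal.ofReal ((2 + τ) / 2 - (d - τ) ^ 2 / 12) ^ n) := by
  have := isProbabilityMeasure_polygonPrior (ρ := ρ) hpos
  have hsimplex := ae_polygonPrior_mem_stdSimplex (ρ := ρ) hpos
  set π := polygonPrior ρ α
  set I := boxesMeeting N K fun θ => ENNReal.ofReal d < distL1 θ.density f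
  set V : Set Param := {θ | (K : ℝ) < (θ.1 : ℝ)} ∪ {θ | θ.2 ∉ stdSimplex ℝ (Fin θ.1)}
  have hV : MeasurableSet V := measurableSet_sigma_iff.2 fun k =>
    (MeasurableSet.const ((K : ℝ) < k)).union (isClosed_stdSimplex ℝ _).measurableSet.compl
  have hπV : π V ≤ π {θ | (K : ℝ) < (θ.1 : ℝ)} :=
    (measure_union_le _ _).trans (by rw [ae_iff.1 hsimplex, add_zero])
  have haffinity : ∀ i ∈ I, ∫⁻ x, ENNReal.ofReal √(boxUpper N i x * f x) ∂lam
      ≤ ENNReal.ofReal ((2 + τ) / 2 - (d - τ) ^ 2 / 12) := by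
    intro i hi
    obtain ⟨hk, θ, hθ, hθd⟩ := mem_boxesMeeting.1 hi
    exact lintegral_sqrt_boxUpper_mul_le hf hd hN hτ hτ1 hτd
      (le_trans (by exact_mod_cast hk) hK) hθ hθd
  calc ∫⁻ X, postDist π X {θ | ENNReal.ofReal d < distL1 θ.density f} ∂(sampleLaw f n)
      ≤ c⁻¹ * s ^ n + c / π (chiSqBall f s) * π V
        + ∑ i ∈ I, (c / π (chiSqBall f s)) ^ (1 / 2 : ℝ)
          * (∫⁻ x, ENNReal.ofReal √(boxUpper N i x * f x) ∂lam) ^ n :=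
        lintegral_postDist_le hf hd
          (hsimplex.mono fun θ hθ => (lintegral_density_of_mem_stdSimplex hθ).le) hB0 hc0 hc hV
          (fun i _ => measurableSet_box N i) (fun i _ => measurable_boxUpper N i)
          (fun i _ θ hθ x hx => density_le_boxUpper hN hθ hx) (setOf_subset_union_box N K _)
    _ ≤ _ := by
        refine add_le_add (by gcongr) ((Finset.sum_le_card_nsmul _ _ _ fun i hi =>
          mul_le_mul_right (pow_le_pow_left' (haffinity i hi) n) _).trans ?_)
        rw [nsmul_eq_mul]
        gcongr
        exact_mod_cast card_boxesMeeting_le N K _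

/-! ### Posterior contraction from prior mass, prior tail and entropy -/

theorem inv_ofReal_exp_mul_pow_le {x : ℝ} (hx : 0 ≤ x) (n : ℕ) (t : ℝ) :
    (ENNReal.ofReal (Real.exp (n * x + t)))⁻¹ * (1 + ENNReal.ofReal x) ^ n
      ≤ ENNReal.ofReal (Real.exp (-t)) := by
  have hpow : (1 + ENNReal.ofReal x) ^ n ≤ ENNReal.ofReal (Real.exp (n * x)) := by
    rw [Real.exp_nat_mul, ENNReal.ofReal_pow (Real.exp_pos _).le, ← ENNReal.ofReal_one,
      ← ENNReal.ofReal_add zero_le_one hx, add_comm]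
    gcongr
    exact Real.add_one_le_exp x
  refine (mul_le_mul' le_rfl hpow).trans_eq ?_
  rw [← ENNReal.ofReal_inv_of_pos (Real.exp_pos _), ← ENNReal.ofReal_mul (by positivity),
    ← Real.exp_neg, ← Real.exp_add]
  ring_nf

theorem ofReal_affinity_pow_le {M ε : ℝ} (hM : 1 ≤ M) (hε : 0 ≤ ε) (hε1 : ε ≤ 1) (n : ℕ) :
    ENNReal.ofReal ((2 + ε ^ 2) / 2 - (M * ε - ε ^ 2) ^ 2 / 12) ^ n
      ≤ ENNReal.ofReal (Real.exp ((1 / 2 - (M - 1) ^ 2 / 12) * (n * ε ^ 2))) := by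
  rw [mul_left_comm, Real.exp_nat_mul, ENNReal.ofReal_pow (Real.exp_pos _).le]
  gcongr
  refine le_trans ?_ (Real.add_one_le_exp _)
  have hdist : (M - 1) * ε ≤ M * ε - ε ^ 2 := by nlinarith
  have hsq : ((M - 1) * ε) ^ 2 ≤ (M * ε - ε ^ 2) ^ 2 :=
    pow_le_pow_left₀ (mul_nonneg (by linarith) hε) hdist 2
  nlinarith

theorem ofReal_exp_div_le {B : ℝ} (hB : 0 < B) {b : ℝ} {p : ℝ≥0∞}
    (hp : ENNReal.ofReal (B * Real.exp (-b)) ≤ p) (c : ℝ) :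
    ENNReal.ofReal (Real.exp c) / p ≤ ENNReal.ofReal (B⁻¹ * Real.exp (c + b)) := by
  refine (ENNReal.div_le_div_left hp _).trans_eq ?_
  rw [← ENNReal.ofReal_div_of_pos (by positivity), Real.exp_add, Real.exp_neg]
  congr 1
  field_simp

theorem ofReal_exp_mul_rpow_half_mul {B : ℝ} (hB : 0 ≤ B) (x y z : ℝ) :
    ENNReal.ofReal (Real.exp x)
        * (ENNReal.ofReal (B * Real.exp y) ^ (1 / 2 : ℝ) * ENNReal.ofReal (Real.exp z))
      = ENNReal.ofReal (B ^ (1 / 2 : ℝ) * Real.exp (x + y / 2 + z)) := by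
  rw [ENNReal.ofReal_rpow_of_nonneg (by positivity) (by norm_num),
    Real.mul_rpow hB (by positivity), ← Real.exp_mul,
    ← ENNReal.ofReal_mul (by positivity), ← ENNReal.ofReal_mul (by positivity),
    mul_assoc, mul_left_comm, ← Real.exp_add, ← Real.exp_add]
  ring_nf

theorem lintegral_postDist_distL1_gt_le_exp_neg {ρ : PMF ℕ+} {α : Measure ℝ}
    (hpos : ∀ (k : ℕ+) (j : Fin k), 0 < (α (bin k j)).toReal)
    {f : ℝ → ℝ} (hf : Measurable f) (hd : IsDensity f) {n N : ℕ} {K : ℕ+}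
    {ε B₁ B₂ b r h M : ℝ} (hε : 0 < ε) (hε1 : ε ≤ 1) (hB₁ : 0 < B₁) (hB₂ : 0 ≤ B₂) (hr : 0 ≤ r)
    (hN : 0 < N) (hKN : (K : ℝ) ≤ ε ^ 2 * N)
    (hball : ENNReal.ofReal (B₁ * Real.exp (-(b * (n * ε ^ 2))))
      ≤ polygonPrior ρ α (chiSqBall f (1 + ENNReal.ofReal (r * ε ^ 2))))
    (htail : polygonPrior ρ α {θ | (K : ℝ) < (θ.1 : ℝ)}
      ≤ ENNReal.ofReal (B₂ * Real.exp (-((r + b + 2) * (n * ε ^ 2)))))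
    (hcard : (K : ℝ≥0∞) * (N + 1) ^ (K : ℕ) ≤ ENNReal.ofReal (Real.exp (h * (n * ε ^ 2))))
    (hM : 1 < M) (hMh : h + (r + b) / 2 + 2 ≤ (M - 1) ^ 2 / 12) :
    ∫⁻ X, postDist (polygonPrior ρ α) X {θ | ENNReal.ofReal (M * ε) < distL1 θ.density f}
        ∂(sampleLaw f n)
      ≤ ENNReal.ofReal ((1 + B₁⁻¹ * B₂ + B₁⁻¹ ^ (1 / 2 : ℝ)) * Real.exp (-(n * ε ^ 2))) := by
  have hball0 : polygonPrior ρ α (chiSqBall f (1 + ENNReal.ofReal (r * ε ^ 2))) ≠ 0 :=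
    ((ENNReal.ofReal_pos.2 (by positivity)).trans_le hball).ne'
  have hMε : ε ^ 2 < M * ε := by
    rw [sq]
    exact mul_lt_mul_of_pos_right (by linarith) hε
  have hratio := ofReal_exp_div_le hB₁ hball ((r + 1) * (n * ε ^ 2))
  have hmain := lintegral_postDist_distL1_gt_le hpos hf hd hN (sq_nonneg ε)
    (pow_le_one₀ hε.le hε1) hMε hKN hball0
    (ENNReal.ofReal_pos.2 (Real.exp_pos ((r + 1) * (n * ε ^ 2)))).ne' ENNReal.ofReal_ne_top n
  have haffinity := ofReal_affinity_pow_le hM.le hε.le hε1 n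
  have hevidence := inv_ofReal_exp_mul_pow_le (mul_nonneg hr (sq_nonneg ε)) n (n * ε ^ 2)
  rw [show n * (r * ε ^ 2) + n * ε ^ 2 = (r + 1) * (n * ε ^ 2) by ring] at hevidence
  set T := n * ε ^ 2
  have hT : 0 ≤ T := by positivity
  have hsieve : ENNReal.ofReal (B₁⁻¹ * Real.exp ((r + 1) * T + b * T))
      * ENNReal.ofReal (B₂ * Real.exp (-((r + b + 2) * T)))
      = ENNReal.ofReal (B₁⁻¹ * B₂ * Real.exp (-T)) := by
    rw [← ENNReal.ofReal_mul (by positivity), mul_mul_mul_comm, ← Real.exp_add]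
    ring_nf
  have hboxes : ENNReal.ofReal (Real.exp (h * T))
      * (ENNReal.ofReal (B₁⁻¹ * Real.exp ((r + 1) * T + b * T)) ^ (1 / 2 : ℝ)
        * ENNReal.ofReal (Real.exp ((1 / 2 - (M - 1) ^ 2 / 12) * T)))
      ≤ ENNReal.ofReal (B₁⁻¹ ^ (1 / 2 : ℝ) * Real.exp (-T)) := by
    rw [ofReal_exp_mul_rpow_half_mul (inv_nonneg.2 hB₁.le)]
    gcongr
    nlinarith [mul_le_mul_of_nonneg_right hMh hT]
  calc _ ≤ _ := hmain
    _ ≤ ENNReal.ofReal (Real.exp (-T)) + ENNReal.ofReal (B₁⁻¹ * B₂ * Real.exp (-T))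
        + ENNReal.ofReal (B₁⁻¹ ^ (1 / 2 : ℝ) * Real.exp (-T)) := by
      refine add_le_add (add_le_add hevidence ?_) ?_
      · exact (mul_le_mul' hratio htail).trans_eq hsieve
      · refine (mul_le_mul' hcard (mul_le_mul' ?_ haffinity)).trans hboxes
        exact ENNReal.rpow_le_rpow hratio (by norm_num)
    _ = _ := by
      rw [← ENNReal.ofReal_add (by positivity) (by positivity),
        ← ENNReal.ofReal_add (by positivity) (by positivity)]
      ring_nf

/-! ### The contraction rate -/

/-- The number of bins, up to rounding, that balances the squared approximation error `k ^ (-2β)`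
against the prior cost `k log n / n` of `k` weights. -/
noncomputable def optBins (β : ℝ) (n : ℕ) : ℝ := ((n : ℝ) / Real.log n) ^ (1 / (2 * β + 1))

theorem eventually_le_log (Q : ℝ) : ∀ᶠ n : ℕ in atTop, Q ≤ Real.log n :=
  (Real.tendsto_log_atTop.comp tendsto_natCast_atTop_atTop).eventually_ge_atTop Q

theorem log_le_half {l : ℝ} (hl : 0 < l) : Real.log l ≤ l / 2 := by
  have h := Real.log_le_sub_one_of_pos (half_pos hl)
  rw [Real.log_div hl.ne' two_ne_zero] at h
  linarith [Real.log_two_lt_d9]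

theorem exists_pnat_mem_Icc_two_mul {x : ℝ} (hx : 1 ≤ x) :
    ∃ k : ℕ+, (k : ℝ) ∈ Icc x (2 * x) := by
  have hlt := Nat.ceil_lt_add_one (zero_le_one.trans hx)
  exact ⟨⟨⌈x⌉₊, Nat.ceil_pos.2 (by linarith)⟩, Nat.le_ceil x, by rw [PNat.mk_coe]; linarith⟩

section Rate

variable {β : ℝ} {n : ℕ}

theorem natCast_pos_of_one_le_log (hn : 1 ≤ Real.log n) : (0 : ℝ) < n := by
  refine Nat.cast_pos.2 (Nat.pos_of_ne_zero ?_)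
  rintro rfl
  norm_num at hn

theorem one_le_div_log (hn : 1 ≤ Real.log n) : 1 ≤ (n : ℝ) / Real.log n := by
  rw [one_le_div (by linarith)]
  linarith [Real.log_le_sub_one_of_pos (natCast_pos_of_one_le_log hn)]

theorem one_le_optBins (hβ : 0 < β) (hn : 1 ≤ Real.log n) : 1 ≤ optBins β n :=
  Real.one_le_rpow (one_le_div_log hn) (by positivity)

theorem rate_eq_optBins_rpow (hn : 1 ≤ Real.log n) : rate β n = optBins β n ^ (-β) := by
  have hl : 0 < Real.log n := by linarith
  rw [rate, optBins, ← Real.rpow_mul (by linarith [one_le_div_log hn]),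
    show 1 / (2 * β + 1) * -β = -(β / (2 * β + 1)) by ring,
    Real.div_rpow (Nat.cast_nonneg n) hl.le, Real.rpow_neg hl.le, div_inv_eq_mul]

theorem optBins_rpow_mul_log (hβ : 0 < β) (hn : 1 ≤ Real.log n) :
    optBins β n ^ (2 * β + 1) * Real.log n = n := by
  have hβ' : 2 * β + 1 ≠ 0 := by positivity
  rw [optBins, ← Real.rpow_mul (by linarith [one_le_div_log hn]), one_div_mul_cancel hβ',
    Real.rpow_one, div_mul_cancel₀ _ (by linarith)]

theorem mul_rate_sq (hβ : 0 < β) (hn : 1 ≤ Real.log n) :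
    n * rate β n ^ 2 = optBins β n * Real.log n := by
  have hm : 0 < optBins β n := by linarith [one_le_optBins hβ hn]
  rw [rate_eq_optBins_rpow hn, ← Real.rpow_natCast, ← Real.rpow_mul hm.le]
  nth_rw 1 [← optBins_rpow_mul_log hβ hn]
  rw [mul_right_comm, ← Real.rpow_add hm,
    show 2 * β + 1 + -β * ((2 : ℕ) : ℝ) = 1 by push_cast; ring, Real.rpow_one]

theorem optBins_mul_log_le (hβ : 0 < β) (hn : 1 ≤ Real.log n) :
    optBins β n * Real.log n ≤ n := by
  conv_rhs => rw [← optBins_rpow_mul_log hβ hn]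
  gcongr
  exact Real.self_le_rpow_of_one_le (one_le_optBins hβ hn) (by linarith)

theorem mul_log_le_log_optBins (hβ : 0 < β) (hn : 1 ≤ Real.log n) :
    1 / (2 * (2 * β + 1)) * Real.log n ≤ Real.log (optBins β n) := by
  have hl : 0 < Real.log n := by linarith
  rw [optBins, Real.log_rpow (by linarith [one_le_div_log hn]),
    Real.log_div (natCast_pos_of_one_le_log hn).ne' hl.ne']
  calc 1 / (2 * (2 * β + 1)) * Real.log n = 1 / (2 * β + 1) * (Real.log n / 2) := by field_simp
    _ ≤ 1 / (2 * β + 1) * (Real.log n - Real.log (Real.log n)) := by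
      gcongr
      linarith [log_le_half hl]

theorem rate_pos (hβ : 0 < β) (hn : 1 ≤ Real.log n) : 0 < rate β n := by
  rw [rate_eq_optBins_rpow hn]
  exact Real.rpow_pos_of_pos (by linarith [one_le_optBins hβ hn]) _

theorem rate_le_one (hβ : 0 < β) (hn : 1 ≤ Real.log n) : rate β n ≤ 1 := by
  rw [rate_eq_optBins_rpow hn]
  exact Real.rpow_le_one_of_one_le_of_nonpos (one_le_optBins hβ hn) (by linarith)

theorem exp_neg_mul_rate_sq_le (hβ : 0 < β) (hn : 1 ≤ Real.log n) :
    Real.exp (-(n * rate β n ^ 2)) ≤ rate β n ^ 2 := by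
  have hn0 := natCast_pos_of_one_le_log hn
  have hlog : Real.log n ≤ n * rate β n ^ 2 := by
    rw [mul_rate_sq hβ hn]
    exact le_mul_of_one_le_left (by linarith) (one_le_optBins hβ hn)
  calc Real.exp (-(n * rate β n ^ 2)) ≤ Real.exp (-Real.log n) := by gcongr
    _ = (n : ℝ)⁻¹ := by rw [Real.exp_neg, Real.exp_log hn0]
    _ ≤ rate β n ^ 2 := by
      rw [inv_le_iff_one_le_mul₀ hn0, mul_comm]
      linarith

theorem tendsto_rate (hβ : 0 < β) : Tendsto (rate β) atTop (𝓝 0) := by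
  have hlog : Tendsto (fun n : ℕ => Real.log n / n) atTop (𝓝 0) :=
    Real.isLittleO_log_id_atTop.tendsto_div_nhds_zero.comp tendsto_natCast_atTop_atTop
  have hpow := hlog.rpow_const (p := β / (2 * β + 1)) (Or.inr (by positivity))
  rw [Real.zero_rpow (by positivity)] at hpow
  refine hpow.congr fun n => ?_
  rw [Real.div_rpow (Real.log_natCast_nonneg n) n.cast_nonneg, rate, Real.rpow_neg n.cast_nonneg,
    div_eq_inv_mul]

theorem polygonPrior_chiSqBall_rate_ge {ρ : PMF ℕ+} {α : Measure ℝ} {f : ℝ → ℝ}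
    (hf : Measurable f) (hd : IsDensity f) {B₁ β₁ C D : ℝ}
    (hB₁ : 0 ≤ B₁) (hβ₁ : 0 ≤ β₁) (hC : 0 ≤ C) (hD : 0 ≤ D) (hβ : 0 < β)
    (hρ : ∀ k : ℕ+, B₁ * Real.exp (-β₁ * (k : ℝ) * Real.log (k : ℝ)) ≤ (ρ k).toReal)
    (hdir : ∀ k : ℕ+, ENNReal.ofReal (Real.exp (-D * (k * (1 + Real.log k))))
      ≤ dirichlet (fun j : Fin k => (α (bin k j)).toReal)
        {w | (⟨k, w⟩ : Param) ∈ chiSqBall f (1 + ENNReal.ofReal (C * ((k : ℝ) ^ (-β)) ^ 2))})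
    (hn : 2 ≤ Real.log n) :
    ENNReal.ofReal (B₁ * Real.exp (-((2 * β₁ + 4 * D) * (n * rate β n ^ 2))))
      ≤ polygonPrior ρ α (chiSqBall f (1 + ENNReal.ofReal (C * rate β n ^ 2))) := by
  have hn1 : 1 ≤ Real.log n := by linarith
  have hm := one_le_optBins hβ hn1
  obtain ⟨k, hmk, hk2⟩ := exists_pnat_mem_Icc_two_mul hm
  have hk0 := natCast_pnat_pos k
  have hkn : (k : ℝ) ≤ n := by nlinarith [optBins_mul_log_le hβ hn1]
  have hlogk : Real.log k ≤ Real.log n := Real.log_le_log hk0 hkn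
  have hball : chiSqBall f (1 + ENNReal.ofReal (C * ((k : ℝ) ^ (-β)) ^ 2))
      ⊆ chiSqBall f (1 + ENNReal.ofReal (C * rate β n ^ 2)) := by
    refine chiSqBall_subset f ?_
    rw [rate_eq_optBins_rpow hn1]
    have := Real.rpow_le_rpow_of_nonpos (by linarith) hmk (neg_nonpos.2 hβ.le)
    gcongr
  calc ENNReal.ofReal (B₁ * Real.exp (-((2 * β₁ + 4 * D) * (n * rate β n ^ 2))))
      ≤ ENNReal.ofReal ((ρ k).toReal * Real.exp (-D * (k * (1 + Real.log k)))) := by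
        refine ENNReal.ofReal_le_ofReal
          (le_trans ?_ (mul_le_mul_of_nonneg_right (hρ k) (Real.exp_pos _).le))
        rw [mul_assoc, ← Real.exp_add, mul_rate_sq hβ hn1]
        gcongr
        have hlog : (k : ℝ) * Real.log k ≤ 2 * optBins β n * Real.log n := by gcongr
        have hone : (k : ℝ) * (1 + Real.log k) ≤ 2 * optBins β n * (2 * Real.log n) := by
          gcongr
          linarith
        nlinarith [mul_le_mul_of_nonneg_left hlog hβ₁, mul_le_mul_of_nonneg_left hone hD]
    _ ≤ ρ k * _ := by
        rw [ENNReal.ofReal_mul ENNReal.toReal_nonneg, ENNReal.ofReal_toReal (ρ.apply_ne_top k)]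
        gcongr
        exact hdir k
    _ ≤ polygonPrior ρ α (chiSqBall f (1 + ENNReal.ofReal (C * rate β n ^ 2))) :=
        (mul_dirichlet_le_polygonPrior k (measurableSet_chiSqBall hf hd _)).trans
          (measure_mono hball)

theorem natCast_mul_sq_add_one_pow_le {K : ℕ} (hn : 2 ≤ n) (hK : K ≤ n) :
    (K : ℝ≥0∞) * (((n ^ 2 : ℕ) : ℝ≥0∞) + 1) ^ K
      ≤ ENNReal.ofReal (Real.exp ((3 * K + 1) * Real.log n)) := by
  have hnat : K * (n ^ 2 + 1) ^ K ≤ n ^ (3 * K + 1) :=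
    calc K * (n ^ 2 + 1) ^ K ≤ n * (n ^ 3) ^ K := by
          gcongr
          nlinarith
      _ = n ^ (3 * K + 1) := by ring
  have hexp : Real.exp ((3 * K + 1) * Real.log n) = ((n ^ (3 * K + 1) : ℕ) : ℝ) := by
    rw [← Real.exp_log (show (0 : ℝ) < ((n ^ (3 * K + 1) : ℕ) : ℝ) by positivity)]
    push_cast
    rw [Real.log_pow]
    push_cast
    rfl
  rw [hexp, ENNReal.ofReal_natCast]
  exact_mod_cast hnat

end Rate

theorem exists_eventually_exists_sieve {β β₂ : ℝ} (hβ : 0 < β) (hβ₂ : 0 < β₂) (a : ℝ) :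
    ∃ h, 0 < h ∧ ∀ᶠ n : ℕ in atTop, ∃ K : ℕ+, 2 ≤ β₂ * Real.log K ∧
      a * (n * rate β n ^ 2) ≤ β₂ / 2 * (K * Real.log K) ∧
      (K : ℝ) ≤ rate β n ^ 2 * ((n ^ 2 : ℕ) : ℝ) ∧
      (K : ℝ≥0∞) * (((n ^ 2 : ℕ) : ℝ≥0∞) + 1) ^ (K : ℕ)
        ≤ ENNReal.ofReal (Real.exp (h * (n * rate β n ^ 2))) := by
  set c := 1 / (2 * (2 * β + 1))
  have : 0 < c := by positivity
  set L := max 1 (2 * a / (β₂ * c))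
  have hL1 : 1 ≤ L := le_max_left _ _
  have hLa : a ≤ β₂ / 2 * c * L := by
    have hle : 2 * a / (β₂ * c) ≤ L := le_max_right _ _
    rw [div_le_iff₀ (by positivity)] at hle
    linarith
  refine ⟨1 + 6 * L, by positivity, ?_⟩
  filter_upwards [eventually_le_log 1, eventually_le_log (2 * L),
    eventually_le_log (2 / (β₂ * c))] with n hn hnL hnβ
  have hm := one_le_optBins hβ hn
  have hmn := optBins_mul_log_le hβ hn
  have hlogm := mul_log_le_log_optBins hβ hn
  have hn0 := natCast_pos_of_one_le_log hn
  have hT := mul_rate_sq hβ hn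
  rw [show rate β n ^ 2 * ((n ^ 2 : ℕ) : ℝ) = n * (n * rate β n ^ 2) by push_cast; ring, hT]
  set m := optBins β n
  set l := Real.log n
  obtain ⟨K, hKm, hK2⟩ := exists_pnat_mem_Icc_two_mul (one_le_mul_of_one_le_of_one_le hL1 hm)
  have hKn : (K : ℝ) ≤ n := by nlinarith
  have hlogK : c * l ≤ Real.log K :=
    hlogm.trans (Real.log_le_log (by linarith)
      ((le_mul_of_one_le_left (by linarith) hL1).trans hKm))
  refine ⟨K, ?_, ?_, hKn.trans (le_mul_of_one_le_right hn0.le ?_), ?_⟩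
  · rw [div_le_iff₀ (by positivity)] at hnβ
    nlinarith
  · calc a * (m * l) ≤ β₂ / 2 * c * L * (m * l) := by gcongr
      _ = β₂ / 2 * (L * m * (c * l)) := by ring
      _ ≤ β₂ / 2 * (K * Real.log K) := by gcongr
  · exact one_le_mul_of_one_le_of_one_le hm hn
  · have hn2 : 2 ≤ n := by
      have : (2 : ℝ) ≤ n := by nlinarith
      exact_mod_cast this
    refine (natCast_mul_sq_add_one_pow_le hn2 (by exact_mod_cast hKn)).trans ?_
    refine ENNReal.ofReal_le_ofReal (Real.exp_le_exp.2 ?_)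
    have hl : 0 ≤ l := by linarith
    nlinarith [mul_le_mul_of_nonneg_right hK2 hl, mul_le_mul_of_nonneg_right hm hl]

/-! ### The Bayes estimator -/

theorem add_sq_le_two_mul (a b : ℝ≥0∞) : (a + b) ^ 2 ≤ 2 * a ^ 2 + 2 * b ^ 2 := by
  rcases eq_or_ne a ∞ with rfl | ha
  · simp
  rcases eq_or_ne b ∞ with rfl | hb
  · simp
  lift a to NNReal using ha
  lift b to NNReal using hb
  exact_mod_cast add_sq_le (a := a) (b := b) |>.trans_eq (mul_add _ _ _)

section BayesEstimator

variable {f : ℝ → ℝ}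

theorem measurable_distL1 (hf : Measurable f) : Measurable fun θ : Param => distL1 θ.density f := by
  simp only [distL1_eq_lintegral]
  have := measurable_density
  exact Measurable.lintegral_prod_right'
    (f := fun z : Param × ℝ => ENNReal.ofReal |z.1.density z.2 - f z.2|) (by fun_prop)

theorem distL1_le_two (hd : IsDensity f) {θ : Param} (hθ : θ.2 ∈ stdSimplex ℝ (Fin θ.1)) :
    distL1 θ.density f ≤ 2 :=
  calc distL1 θ.density f
      ≤ ∫⁻ x, (ENNReal.ofReal (θ.density x) + ENNReal.ofReal (f x)) ∂lam := by
        rw [distL1_eq_lintegral]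
        refine lintegral_mono_ae ?_
        filter_upwards [ae_lam_mem] with x hx
        have hθ0 : 0 ≤ θ.density x := polygon_nonneg hθ.1 hx
        rw [← ENNReal.ofReal_add hθ0 (hd.1 x hx)]
        refine ENNReal.ofReal_le_ofReal ((abs_sub _ _).trans_eq ?_)
        rw [abs_of_nonneg hθ0, abs_of_nonneg (hd.1 x hx)]
    _ = 2 := by
        rw [lintegral_add_left measurable_density.of_uncurry_left.ennreal_ofReal,
          lintegral_density_of_mem_stdSimplex hθ, hd.2, one_add_one_eq_two]

section Mixture

variable {ν : Measure Param} [IsProbabilityMeasure ν]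
  (hν : ∀ᵐ θ ∂ν, θ.2 ∈ stdSimplex ℝ (Fin θ.1))

include hν

theorem integrable_uncurry_density : Integrable (Function.uncurry Param.density) (ν.prod lam) := by
  have hm := measurable_density.aestronglyMeasurable (μ := ν.prod lam)
  refine (integrable_prod_iff hm).2 ⟨.of_forall fun θ => integrable_polygon θ.1 θ.2, ?_⟩
  refine (integrable_const (1 : ℝ)).congr (hν.mono fun θ hθ => ?_)
  have h0 : 0 ≤ᵐ[lam] θ.density := by
    filter_upwards [ae_lam_mem] with x hx using polygon_nonneg hθ.1 hx
  calc (1 : ℝ) = ∫ x, θ.density x ∂lam := by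
        rw [integral_eq_lintegral_of_nonneg_ae h0 (integrable_polygon θ.1 θ.2).1,
          lintegral_density_of_mem_stdSimplex hθ, ENNReal.toReal_one]
    _ = ∫ x, ‖θ.density x‖ ∂lam :=
        integral_congr_ae (h0.mono fun x hx => (Real.norm_of_nonneg hx).symm)

theorem distL1_integral_density_le (hf : Measurable f) :
    distL1 (fun x => ∫ θ, θ.density x ∂ν) f ≤ ∫⁻ θ, distL1 θ.density f ∂ν := by
  have := measurable_density
  have hm : Measurable fun z : ℝ × Param => ENNReal.ofReal |z.2.density z.1 - f z.1| := by
    fun_prop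
  simp only [distL1_eq_lintegral]
  rw [← lintegral_lintegral_swap hm.aemeasurable]
  refine lintegral_mono_ae ?_
  filter_upwards [(integrable_uncurry_density hν).prod_left_ae] with x hx
  have hsub : ∫ θ, θ.density x ∂ν - f x = ∫ θ, (θ.density x - f x) ∂ν := by
    rw [integral_sub (f := fun θ : Param => θ.density x) hx (integrable_const _), integral_const,
      probReal_univ, one_smul]
  simp only [hsub, ← Real.enorm_eq_ofReal_abs]
  exact enorm_integral_le_lintegral_enorm _

theorem lintegral_distL1_density_le (hf : Measurable f) (hd : IsDensity f) (r : ℝ≥0∞) :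
    ∫⁻ θ, distL1 θ.density f ∂ν ≤ r + 2 * ν {θ | r < distL1 θ.density f} :=
  calc ∫⁻ θ, distL1 θ.density f ∂ν
      ≤ ∫⁻ θ, (r + {θ : Param | r < distL1 θ.density f}.indicator (fun _ => 2) θ) ∂ν := by
        refine lintegral_mono_ae ?_
        filter_upwards [hν] with θ hθ
        by_cases h : r < distL1 θ.density f
        · rw [indicator_of_mem (show θ ∈ {θ : Param | r < distL1 θ.density f} from h)]
          exact (distL1_le_two hd hθ).trans le_add_self
        · exact (not_lt.1 h).trans le_self_add
    _ = r + 2 * ν {θ | r < distL1 θ.density f} := by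
        rw [lintegral_add_left measurable_const, lintegral_const, measure_univ, mul_one,
          lintegral_indicator_const (measurableSet_lt measurable_const (measurable_distL1 hf))]

end Mixture

variable {π : Measure Param} {n : ℕ}

theorem distL1_bayesEstimator_le (hf : Measurable f) (hd : IsDensity f)
    (hπ : ∀ᵐ θ ∂π, θ.2 ∈ stdSimplex ℝ (Fin θ.1)) {X : Fin n → ℝ}
    [IsProbabilityMeasure (postDist π X)] (r : ℝ≥0∞) :
    distL1 (bayesEstimator π X) f ≤ r + 2 * postDist π X {θ | r < distL1 θ.density f} := by
  have hpost : ∀ᵐ θ ∂(postDist π X), θ.2 ∈ stdSimplex ℝ (Fin θ.1) := by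
    rw [postDist_eq_bayesPosterior]
    exact bayesPosterior_absolutelyContinuous.ae_le hπ
  exact (distL1_integral_density_le hpost hf).trans (lintegral_distL1_density_le hpost hf hd r)

theorem lintegral_distL1_bayesEstimator_sq_le (hf : Measurable f) (hd : IsDensity f)
    (hπ : ∀ᵐ θ ∂π, θ.2 ∈ stdSimplex ℝ (Fin θ.1))
    (hprob : ∀ᵐ X ∂(sampleLaw f n), IsProbabilityMeasure (postDist π X)) (r : ℝ≥0∞) :
    ∫⁻ X, distL1 (bayesEstimator π X) f ^ 2 ∂(sampleLaw f n)
      ≤ 2 * r ^ 2 + 8 * ∫⁻ X, postDist π X {θ | r < distL1 θ.density f} ∂(sampleLaw f n) := by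
  have := isProbabilityMeasure_sampleLaw hd n
  calc ∫⁻ X, distL1 (bayesEstimator π X) f ^ 2 ∂(sampleLaw f n)
      ≤ ∫⁻ X, (2 * r ^ 2 + 8 * postDist π X {θ | r < distL1 θ.density f}) ∂(sampleLaw f n) := by
        refine lintegral_mono_ae (hprob.mono fun X hX => ?_)
        set q := postDist π X {θ | r < distL1 θ.density f}
        calc distL1 (bayesEstimator π X) f ^ 2 ≤ (r + 2 * q) ^ 2 := by
              gcongr
              exact distL1_bayesEstimator_le hf hd hπ r
          _ ≤ 2 * r ^ 2 + 2 * (2 * q) ^ 2 := add_sq_le_two_mul _ _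
          _ = 2 * r ^ 2 + 8 * q ^ 2 := by ring
          _ ≤ 2 * r ^ 2 + 8 * q := by
              gcongr
              exact pow_le_of_le_one zero_le prob_le_one two_ne_zero
    _ = 2 * r ^ 2 + 8 * ∫⁻ X, postDist π X {θ | r < distL1 θ.density f} ∂(sampleLaw f n) := by
        rw [lintegral_add_left measurable_const, lintegral_const, measure_univ, mul_one,
          lintegral_const_mul' _ _ (by norm_num)]

end BayesEstimator

/-! ### Contraction of the posterior and of the Bayes estimator -/

section Contraction

variable {ρ : PMF ℕ+} {B₁ B₂ β₁ β₂ : ℝ} (hB₁ : 0 < B₁) (hB₂ : 0 ≤ B₂) (hβ₁ : 0 ≤ β₁) (hβ₂ : 0 < β₂)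
  (hρ : ∀ k : ℕ+, B₁ * Real.exp (-β₁ * (k : ℝ) * Real.log (k : ℝ)) ≤ (ρ k).toReal ∧
    (ρ k).toReal ≤ B₂ * Real.exp (-β₂ * (k : ℝ) * Real.log (k : ℝ)))
  {α : Measure ℝ} (hpos : ∀ (k : ℕ+) (j : Fin k), 0 < (α (bin k j)).toReal)
  {f : ℝ → ℝ} (hf : Measurable f) (hd : IsDensity f) {β C D : ℝ}
  (hβ : 0 < β) (hC : 0 ≤ C) (hD : 0 ≤ D)
  (hdir : ∀ k : ℕ+, ENNReal.ofReal (Real.exp (-D * (k * (1 + Real.log k))))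
    ≤ dirichlet (fun j : Fin k => (α (bin k j)).toReal)
      {w | (⟨k, w⟩ : Param) ∈ chiSqBall f (1 + ENNReal.ofReal (C * ((k : ℝ) ^ (-β)) ^ 2))})

include hB₁ hB₂ hβ₁ hβ₂ hρ hpos hf hd hβ hC hD hdir

theorem exists_lintegral_postDist_distL1_gt_le :
    ∃ M₀ A : ℝ, 0 < M₀ ∧ 0 ≤ A ∧ ∀ M : ℝ, M₀ ≤ M → ∀ᶠ n : ℕ in atTop,
      ∫⁻ X, postDist (polygonPrior ρ α) X
        {θ | ENNReal.ofReal (M * rate β n) < distL1 θ.density f} ∂(sampleLaw f n)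
        ≤ ENNReal.ofReal (A * rate β n ^ 2) := by
  set b := 2 * β₁ + 4 * D
  set S := ∑' k : ℕ, Real.exp (-(k : ℝ))
  have : 0 ≤ S := tsum_nonneg fun k => (Real.exp_pos _).le
  obtain ⟨h, hh, hsieve⟩ := exists_eventually_exists_sieve hβ hβ₂ (C + b + 2)
  set Q := 12 * (h + (C + b) / 2 + 2) with hQ
  have : 1 ≤ Q := by
    have : 0 ≤ b := by positivity
    linarith
  refine ⟨1 + Q, 1 + B₁⁻¹ * (B₂ * S) + B₁⁻¹ ^ (1 / 2 : ℝ), by linarith, by positivity,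
    fun M hM => ?_⟩
  filter_upwards [eventually_le_log 2, hsieve] with n hn ⟨K, hK2, hKa, hKN, hcard⟩
  have hn1 : 1 ≤ Real.log n := by linarith
  have htail : polygonPrior ρ α {θ | (K : ℝ) < (θ.1 : ℝ)}
      ≤ ENNReal.ofReal (B₂ * S * Real.exp (-((C + b + 2) * (n * rate β n ^ 2)))) := by
    refine (polygonPrior_fst_gt_le hB₂ hβ₂.le (fun k => (hρ k).2) hpos
      (mod_cast Nat.one_le_of_lt K.pos) hK2).trans ?_
    rw [mul_right_comm]
    exact ENNReal.ofReal_le_ofReal (mul_le_mul_of_nonneg_left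
      (Real.exp_le_exp.2 (neg_le_neg hKa)) (by positivity))
  have hMQ : h + (C + b) / 2 + 2 ≤ (M - 1) ^ 2 / 12 := by nlinarith
  refine (lintegral_postDist_distL1_gt_le_exp_neg hpos hf hd (rate_pos hβ hn1) (rate_le_one hβ hn1)
    hB₁ (by positivity) hC (pow_pos (Nat.cast_pos.1 (natCast_pos_of_one_le_log hn1)) 2) hKN
    (polygonPrior_chiSqBall_rate_ge hf hd hB₁.le hβ₁ hC hD hβ (fun k => (hρ k).1) hdir hn) htail
    hcard (by linarith) hMQ).trans ?_
  gcongr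
  exact exp_neg_mul_rate_sq_le hβ hn1

theorem exists_tendsto_lintegral_postDist_distL1_gt :
    ∃ M₀ : ℝ, 0 < M₀ ∧ ∀ M : ℝ, M₀ ≤ M →
      Tendsto (fun n : ℕ => ∫⁻ X, postDist (polygonPrior ρ α) X
        {θ | ENNReal.ofReal (M * rate β n) < distL1 θ.density f} ∂(sampleLaw f n))
        atTop (𝓝 0) := by
  obtain ⟨M₀, A, hM₀, -, hle⟩ := exists_lintegral_postDist_distL1_gt_le hB₁ hB₂ hβ₁ hβ₂ hρ hpos
    hf hd hβ hC hD hdir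
  have hlim : Tendsto (fun n => ENNReal.ofReal (A * rate β n ^ 2)) atTop (𝓝 0) := by
    simpa using ENNReal.tendsto_ofReal (((tendsto_rate hβ).pow 2).const_mul A)
  exact ⟨M₀, hM₀, fun M hM => tendsto_of_tendsto_of_tendsto_of_le_of_le' tendsto_const_nhds hlim
    (.of_forall fun _ => zero_le) (hle M hM)⟩

theorem exists_lintegral_distL1_bayesEstimator_sq_le :
    ∃ A : ℝ, 0 < A ∧ ∀ᶠ n : ℕ in atTop,
      ∫⁻ X, distL1 (bayesEstimator (polygonPrior ρ α) X) f ^ 2 ∂(sampleLaw f n)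
        ≤ ENNReal.ofReal (A * rate β n ^ 2) := by
  obtain ⟨M₀, A, hM₀, hA, hle⟩ := exists_lintegral_postDist_distL1_gt_le hB₁ hB₂ hβ₁ hβ₂ hρ hpos
    hf hd hβ hC hD hdir
  have := isProbabilityMeasure_polygonPrior (ρ := ρ) hpos
  have hsimplex := ae_polygonPrior_mem_stdSimplex (ρ := ρ) hpos
  refine ⟨2 * M₀ ^ 2 + 8 * A, by positivity, ?_⟩
  filter_upwards [hle M₀ le_rfl, eventually_le_log 2] with n hn hlog
  have hrate := rate_pos hβ (one_le_two.trans hlog)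
  have hball := (ENNReal.ofReal_pos.2 (by positivity)).trans_le
    (polygonPrior_chiSqBall_rate_ge hf hd hB₁.le hβ₁ hC hD hβ (fun k => (hρ k).1) hdir hlog)
  have hprob := ae_isProbabilityMeasure_postDist hf hd
    (hsimplex.mono fun θ hθ => (lintegral_density_of_mem_stdSimplex hθ).le)
    (ENNReal.add_ne_top.2 ⟨ENNReal.one_ne_top, ENNReal.ofReal_ne_top⟩) hball.ne' n
  calc ∫⁻ X, distL1 (bayesEstimator (polygonPrior ρ α) X) f ^ 2 ∂(sampleLaw f n)
      ≤ 2 * ENNReal.ofReal (M₀ * rate β n) ^ 2 + 8 * ENNReal.ofReal (A * rate β n ^ 2) :=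
        (lintegral_distL1_bayesEstimator_sq_le hf hd hsimplex hprob _).trans (by gcongr)
    _ = ENNReal.ofReal ((2 * M₀ ^ 2 + 8 * A) * rate β n ^ 2) := by
        rw [← ENNReal.ofReal_pow (by positivity), ← ENNReal.ofReal_ofNat 2,
          ← ENNReal.ofReal_ofNat 8, ← ENNReal.ofReal_mul (by positivity),
          ← ENNReal.ofReal_mul (by positivity),
          ← ENNReal.ofReal_add (by positivity) (by positivity)]
        congr 1
        ring

end Contraction

/-! ### Changing the density outside `[0, 1]` -/

section Congr

variable {f g : ℝ → ℝ} (h : EqOn f g (Icc 0 1))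

include h

theorem sampleLaw_congr (n : ℕ) : sampleLaw f n = sampleLaw g n := by
  have hfg : (fun x => ENNReal.ofReal (f x)) =ᵐ[lam] fun x => ENNReal.ofReal (g x) := by
    filter_upwards [ae_lam_mem] with x hx using by rw [h hx]
  simp only [sampleLaw, withDensity_congr_ae hfg]

theorem distL1_congr_right (p : ℝ → ℝ) : distL1 p f = distL1 p g := by
  simp only [distL1_eq_lintegral]
  exact setLIntegral_congr_fun measurableSet_Icc fun x hx => by simp only [h hx]

theorem IsDensity.congr (hf : IsDensity f) : IsDensity g := by
  refine ⟨fun x hx => (hf.1 x hx).trans_eq (h hx), hf.2.symm.trans ?_ |>.symm⟩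
  exact setLIntegral_congr_fun measurableSet_Icc fun x hx => by simp only [h hx]

end Congr

theorem HolderSmooth.exists_continuous_polygon_approx {β : ℝ} (hβ : 0 < β) (hβ2 : β ≤ 2)
    {f : ℝ → ℝ} (hf : HolderSmooth β f) (hBC : 1 < β → BC1 β f ∧ BC2 β f) :
    ∃ g : ℝ → ℝ, Continuous g ∧ EqOn f g (Icc 0 1) ∧ ∃ A : ℝ, 1 ≤ A ∧
      ∀ (k : ℕ+), ∀ x ∈ Icc (0 : ℝ) 1,
        |polygon k (fun j => g (mid k j) / k) x - g x| ≤ A * (k : ℝ) ^ (-β) := by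
  obtain ⟨A, hA, happ⟩ := exists_polygon_approx hβ hβ2 hf hBC
  have heq : EqOn f (IccExtend zero_le_one ((Icc (0 : ℝ) 1).domRestrict f)) (Icc 0 1) :=
    fun x hx => (IccExtend_of_mem zero_le_one ((Icc (0 : ℝ) 1).domRestrict f) hx).symm
  refine ⟨_, (continuousOn_iff_continuous_domRestrict.1 hf.1.continuousOn).Icc_extend', heq, A, hA,
    fun k x hx => ?_⟩
  rw [← heq hx]
  have hmid (j : Fin k) := heq (mid_mem_Icc j.2)
  simpa only [← hmid] using happ k x hx

end RandomPolygon

open RandomPolygon in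
theorem theorem1
    -- the prior on the number of bins
    (ρ : PMF ℕ+) (B₁ B₂ β₁ β₂ : ℝ) (hB₁ : 0 < B₁) (hB₂ : 0 < B₂) (hβ₁ : 0 < β₁) (hβ₂ : 0 < β₂)
    (hρ : ∀ k : ℕ+, B₁ * Real.exp (-β₁ * (k : ℝ) * Real.log (k : ℝ)) ≤ (ρ k).toReal ∧
      (ρ k).toReal ≤ B₂ * Real.exp (-β₂ * (k : ℝ) * Real.log (k : ℝ)))
    -- the base measure of the Dirichlet process
    (α : Measure ℝ) (a : ℝ → ℝ) (ha : ContinuousOn a (Icc 0 1)) (ha' : ∀ x ∈ Icc (0 : ℝ) 1, 0 < a x)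
    (hα : α = lam.withDensity fun x => ENNReal.ofReal (a x)) :
    ∀ β : ℝ, 0 < β → β ≤ 2 → ∀ f₀ : ℝ → ℝ,
      IsDensity f₀ → HolderSmooth β f₀ → ∫⁻ x, (ENNReal.ofReal (f₀ x))⁻¹ ∂lam < ⊤ →
      (1 < β → BC1 β f₀ ∧ BC2 β f₀) →
      (∃ M₀ : ℝ, 0 < M₀ ∧ ∀ M : ℝ, M₀ ≤ M →
        Tendsto (fun n : ℕ => ∫⁻ X, postDist (polygonPrior ρ α) X
            {θ | ENNReal.ofReal (M * rate β n) < distL1 θ.density f₀} ∂(sampleLaw f₀ n))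
          atTop (𝓝 0)) ∧
      (∃ C : ℝ, 0 < C ∧ ∀ᶠ n : ℕ in atTop,
        ∫⁻ X, distL1 (bayesEstimator (polygonPrior ρ α) X) f₀ ^ 2 ∂(sampleLaw f₀ n)
          ≤ ENNReal.ofReal (C * rate β n ^ 2)) := by
  intro β hβ hβ2 f₀ hd₀ hf₀ hJ₀ hBC
  obtain ⟨f, hf, heq, A, hA, happ⟩ := hf₀.exists_continuous_polygon_approx hβ hβ2 hBC
  have hd : IsDensity f := hd₀.congr heq
  have hJ : ∫⁻ x, (ENNReal.ofReal (f x))⁻¹ ∂lam < ⊤ := by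
    refine (setLIntegral_congr_fun measurableSet_Icc fun x hx => ?_).trans_lt hJ₀
    simp only [heq hx]
  obtain ⟨F, hF⟩ := isCompact_Icc.exists_bound_of_continuousOn hf.continuousOn
  obtain ⟨c, C', hc, hbin⟩ := exists_bin_bounds ha ha'
  rw [← hα] at hbin
  have hpos (k : ℕ+) (j : Fin k) : 0 < (α (bin k j)).toReal :=
    (div_pos hc (natCast_pnat_pos k)).trans_le (hbin k j).1
  obtain ⟨C, D, hC, hD, hdir⟩ := exists_dirichlet_chiSqBall_ge hf.measurable hd
    (fun x hx => (le_abs_self _).trans (hF x hx)) hA hβ hc C' happ hJ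
  have hball (k : ℕ+) := hdir k (fun j => (α (bin k j)).toReal) (hbin k)
  simp only [sampleLaw_congr heq, distL1_congr_right heq]
  exact ⟨exists_tendsto_lintegral_postDist_distL1_gt hB₁ hB₂.le hβ₁.le hβ₂ hρ hpos hf.measurable hd
      hβ hC.le hD.le hball,
    exists_lintegral_distL1_bayesEstimator_sq_le hB₁ hB₂.le hβ₁.le hβ₂ hρ hpos hf.measurable hd
      hβ hC.le hD.le hball⟩
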